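/- Let $(E,d)$ be a Polish space (complete separable metric space), $n\ge 1$, and let $X_1,\dots,X_n$ be i.i.d. $E$-valued random variables on a probability space $(\Omega,\mathcal A,\mathbb P)$ with law $\mu$; let $L_n=\frac1n\sum_{i=1}^n\delta_{X_i}$. Fix $x_0\in E$ and $S\subset E$ with $\mu(S)=1$, and write $B(x,r)$ for the closed ball. For $A\subset E$ let $N(A,\delta)$ be the least number of closed balls of radius $\delta$ with centers in $A$ that cover $A$. For $p\ge 1$ put $$W_p^p(\mu,\nu)=\inf_\pi\int d(x,y)^p\,\pi(dx,dy)$$ (infimum over probability measures $\pi$ on $E\times E$ with marginals $\mu,\nu$), $H(t)=\mu(B(x_0,t)^c)$, $\|X\|_{q,w}^q=\sup_{t\ge0}t^qH(t)$ (one says that $\mu$ has a weak moment of order $q$ if this is finite), $I_{2p,p}=\int_0^\infty\sqrt{H(t)}\,t^{p-1}\,dt$, and $\|d(x_0,X)\|_p^p=\int d(x_0,y)^p\,\mu(dy)$. **Theorem.** Let $p\ge1$ and assume that, for some $\alpha\in(0,2p)$ and $\beta>0$, $$N(S\cap B(x_0,r),\delta)\le\beta\Big(\frac{2r}{\delta}\Big)^{\alpha}\qquad\text{for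 all } r>0 \text{ and } \delta\in(0,2r].$$ Below, $C_{a_1,\dots,a_k}$ denotes a positive constant that depends only on $a_1,\dots,a_k$ (and may differ from one occurrence to another). 1. If $\mu$ has a weak moment of order $rp$ with $r>2$, then $I_{2p,p}<\infty$, $\|d(x_0,X)\|_p<\infty$ and, for all $q>r$ and all $x>0$, $$\mathbb P\big(W_p^p(\mu,L_n)>x\big)\le e^2\exp\Big(-n\,C_{p,\alpha,\beta}\Big[\frac{x}{I_{2p,p}}\Big]^2\Big)\mathbf 1_{x\le C_p\|d(x_0,X)\|_p^p}+C_{p,q,r}\Big\{\frac{I_{2p,p}^q}{x^qn^{q/2}}+\frac{\|X\|_{rp,w}^{rp}}{x^rn^{r-1}}\Big\}.$$ (If $I_{2p,p}=0$, then $\|d(x_0,X)\|_p=0$, and the first term is read as $0$.) 2. If $I_{2p,p}<\infty$, then, for all $x>0$, $$\mathbb P\big(W_p^p(\mu,L_n)>x\big)\le C_{p,\alpha,\beta}\,\frac{I_{2p,p}^2}{x^2n}.$$ 3. If $\mu$ has a weak moment of order $rp$ with $r\in(1,2)$, then, for all $x>0$, $$\mathbb P\big(W_p^p(\mu,L_n)>x\big)\le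 C_{p,\alpha,\beta,r}\,\frac{\|X\|_{rp,w}^{rp}}{x^rn^{r-1}}.$$ -/

import Mathlib

open MeasureTheory ProbabilityTheory Metric Set
open scoped NNReal ENNReal

noncomputable section

namespace EmpiricalWasserstein

variable {E : Type*} [MetricSpace E] [MeasurableSpace E]

/-- `W_p^p(μ, ν)`: the infimum of `∫ d(x, y)^p dπ(x, y)` over all probability measures `π` on
`E × E` with marginals `μ` and `ν`, as an extended nonnegative real. -/
def wassersteinPow (p : ℝ) (μ ν : Measure E) : ℝ≥0∞ :=
  ⨅ (π : Measure (E × E)) (_ : IsProbabilityMeasure π ∧ π.fst = μ ∧ π.snd = ν),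
    ∫⁻ z, edist z.1 z.2 ^ p ∂π

/-- The empirical measure `L_n = (1/n) ∑ δ_{x_i}` of a sample `x_1, …, x_n`. -/
def empiricalMeasure {n : ℕ} (x : Fin n → E) : Measure E :=
  (n : ℝ≥0∞)⁻¹ • ∑ i, Measure.dirac (x i)

/-- The tail `H(t) = μ(B(x₀, t)ᶜ)`, with `B(x₀, t)` the closed ball. -/
def tail (μ : Measure E) (x₀ : E) (t : ℝ) : ℝ≥0∞ :=
  μ (closedBall x₀ t)ᶜ

/-- The `q`-th power `‖X‖_{q,w}^q = sup_{t ≥ 0} t^q H(t)` of the weak moment of order `q` of `μ`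
(with respect to `x₀`); `μ` has a weak moment of order `q` when this is not `∞`. -/
def weakMoment (q : ℝ) (μ : Measure E) (x₀ : E) : ℝ≥0∞ :=
  ⨆ (t : ℝ) (_ : 0 ≤ t), ENNReal.ofReal (t ^ q) * tail μ x₀ t

/-- `I_{2p,p} = ∫_0^∞ √H(t) t^(p-1) dt`. -/
def tailIntegral (p : ℝ) (μ : Measure E) (x₀ : E) : ℝ≥0∞ :=
  ∫⁻ t in Ioi (0 : ℝ), tail μ x₀ t ^ (1 / 2 : ℝ) * ENNReal.ofReal (t ^ (p - 1))

/-- The strong moment `‖d(x₀, X)‖_p^p = ∫ d(x₀, y)^p dμ(y)`. -/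
def strongMoment (p : ℝ) (μ : Measure E) (x₀ : E) : ℝ≥0∞ :=
  ∫⁻ y, edist x₀ y ^ p ∂μ

/-- The uniform covering condition: `N(S ∩ B(x₀, r), δ) ≤ β (2r/δ)^α` for all `r > 0` and
`0 < δ ≤ 2r`, where `N(A, δ)` is the least number of closed balls of radius `δ` with centers in
`A` that cover `A`. -/
def UniformCovering (S : Set E) (x₀ : E) (α β : ℝ) : Prop :=
  ∀ (r : ℝ) (δ : ℝ≥0), 0 < r → 0 < δ → (δ : ℝ) ≤ 2 * r →
    (coveringNumber δ (S ∩ closedBall x₀ r) : ℝ≥0∞) ≤ ENNReal.ofReal (β * (2 * r / δ) ^ α)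

end EmpiricalWasserstein

end

/-! Transport is done by chaining. Split `E` into dyadic shells around `x₀` and each shell of radius
`2 ^ k` into nested cells of diameter of order `2 ^ k * 2 ^ (-l)`. Matching as much mass as possible
in the finest cells, then in coarser ones, and sending the rest through `x₀`, bounds the cost by a
negligible finest-level term plus the sum over levels and cells of `2 ^ (-p l) * r ^ p * |μ(C) -
L_n(C)|`, where `r` is the radius of the shell (`exists_multilevel_coupling`, `exists_cells`).

The empirical mass of a cell `C` has standard deviation at most `√(μ(C) / n)`. By Cauchy-Schwarz,
the cells of level `l` in one shell together contribute `√(N_l * mass / n)` with `N_l` of order `2 ^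
(α l)`. The sum over levels converges exactly because `α < 2p` (`entropyConst_ne_top`), and the sum
over shells of `r ^ p * √mass` is comparable to the tail integral (`tsum_shellRadius_mul_sqrt_le`).
So the weighted deviation has second moment of order `I ^ 2 / n`, and Chebyshev gives the second
regime.

In the third regime that sum over shells may diverge. Shells with `r ^ p ≤ n x` are treated by
Chebyshev and the others by Markov; both parts have the order of the weak moment over `x ^ r * n ^
(r - 1)`.

In the first regime the cut is at `r ^ p` of order `n x / q`. The outer part is again handled by
Markov. The inner deviation is a function of independent variables in which one sample point has
small influence, so a Bennett bound with a well-chosen parameter gives the polynomial Fuk-Nagaev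
tail (`measure_sub_integral_ge_le`), provided its mean is at most a small multiple of `x`. That
fails only if `x` is below a multiple of the strong moment and `n (x / I) ^ 2` is bounded; there the
exponential term of the claim is already at least one. -/

namespace EmpiricalWasserstein

/-! ### Coupling two measures along nested partitions. -/

section Coupling

theorem pairwise_disjoint_fiber {E ι : Type*} (g : E → ι) :
    Pairwise (Function.onFun Disjoint fun i => g ⁻¹' {i}) := by
  intro i j hij
  refine Set.disjoint_left.2 fun x hx hy => hij ?_
  simp only [mem_preimage, mem_singleton_iff] at hx hy
  rw [← hx, hy]

variable {E ι : Type*} [MeasurableSpace E] [MeasurableSpace ι] [MeasurableSingletonClass ι]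

/-- The part of `μ` that is left over once, in each cell `g = i`, the common mass of `μ` and `ν`
has been removed. -/
noncomputable def residual (g : E → ι) (μ ν : Measure E) : Measure E :=
  Measure.sum fun i => (1 - ν (g ⁻¹' {i}) / max (μ (g ⁻¹' {i})) (ν (g ⁻¹' {i}))) •
    μ.restrict (g ⁻¹' {i})

/-- With masses `a` and `b` in the cell, the density of the residual is `1 - b / max a b`, which
leaves the truncated difference `a - b`. The degenerate cases are those where a quotient `0 / 0`
could appear. -/
theorem residual_apply {g : E → ι} (hg : Measurable g) (μ ν : Measure E)
    [IsFiniteMeasure μ] [IsFiniteMeasure ν] (i : ι) :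
    residual g μ ν (g ⁻¹' {i}) = μ (g ⁻¹' {i}) - ν (g ⁻¹' {i}) := by
  have hm := hg (measurableSet_singleton i)
  rw [residual, Measure.sum_apply _ hm, tsum_eq_single i]
  · rw [Measure.smul_apply, Measure.restrict_apply hm, inter_self, smul_eq_mul]
    set a := μ (g ⁻¹' {i})
    set b := ν (g ⁻¹' {i})
    have ha : a ≠ ∞ := measure_ne_top _ _
    have hb : b ≠ ∞ := measure_ne_top _ _
    rcases le_total a b with h | h
    · rw [max_eq_right h, tsub_eq_zero_of_le h]
      rcases eq_or_ne b 0 with h0 | h0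
      · rw [h0] at h
        rw [nonpos_iff_eq_zero.1 h, mul_zero]
      · rw [ENNReal.div_self h0 hb, tsub_self, zero_mul]
    · rw [max_eq_left h]
      rcases eq_or_ne a 0 with h0 | h0
      · rw [h0, mul_zero, zero_tsub]
      · rw [ENNReal.sub_mul (fun _ _ => ha), one_mul, ENNReal.div_mul_cancel h0 ha]
  · intro j hj
    have : g ⁻¹' {i} ∩ g ⁻¹' {j} = ∅ :=
      Set.disjoint_iff_inter_eq_empty.1 (pairwise_disjoint_fiber g hj.symm)
    rw [Measure.smul_apply, Measure.restrict_apply hm, this, measure_empty, smul_zero]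

variable [Countable ι]

theorem sum_restrict_fiber {g : E → ι} (hg : Measurable g) (μ : Measure E) :
    (Measure.sum fun i => μ.restrict (g ⁻¹' {i})) = μ := by
  rw [← Measure.restrict_iUnion (pairwise_disjoint_fiber g)
    fun i => hg (measurableSet_singleton i)]
  have : ⋃ i, g ⁻¹' {i} = univ := by
    ext x
    simp
  rw [this, Measure.restrict_univ]

theorem sum_add_residual {g : E → ι} (hg : Measurable g) (μ ν : Measure E) :
    (Measure.sum fun i => (ν (g ⁻¹' {i}) / max (μ (g ⁻¹' {i})) (ν (g ⁻¹' {i}))) •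
      μ.restrict (g ⁻¹' {i})) + residual g μ ν = μ := by
  rw [residual, Measure.sum_add_sum]
  conv_rhs => rw [← sum_restrict_fiber hg μ]
  congr 1
  ext1 i
  rw [← add_smul, add_tsub_cancel_of_le, one_smul]
  exact ENNReal.div_le_of_le_mul (by rw [one_mul]; exact le_max_right _ _)

/-- Two finite measures can be coupled inside the cells of a countable partition, up to the
residual masses. -/
theorem exists_partial_coupling {g : E → ι} (hg : Measurable g) (μ ν : Measure E)
    [IsFiniteMeasure μ] [IsFiniteMeasure ν] :
    ∃ π : Measure (E × E), π.fst + residual g μ ν = μ ∧ π.snd + residual g ν μ = ν ∧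
      ∀ᵐ z ∂π, g z.1 = g z.2 := by
  -- Dividing the product of the two restrictions by the larger mass uses up the smaller mass
  -- completely, so the marginals are exactly what `residual` leaves out. Cells that are null for
  -- both measures contribute nothing.
  refine ⟨Measure.sum fun i => (max (μ (g ⁻¹' {i})) (ν (g ⁻¹' {i})))⁻¹ •
    (μ.restrict (g ⁻¹' {i})).prod (ν.restrict (g ⁻¹' {i})), ?_, ?_, ?_⟩
  · conv_rhs => rw [← sum_add_residual hg μ ν]
    rw [Measure.fst_sum]
    congr 2
    ext1 i
    rw [Measure.fst, Measure.map_smul, Measure.map_fst_prod, Measure.restrict_apply_univ, smul_smul,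
      mul_comm, div_eq_mul_inv]
  · conv_rhs => rw [← sum_add_residual hg ν μ]
    rw [Measure.snd_sum]
    congr 2
    ext1 i
    rw [Measure.snd, Measure.map_smul, Measure.map_snd_prod, Measure.restrict_apply_univ, smul_smul,
      mul_comm, div_eq_mul_inv, max_comm]
  · have hm : MeasurableSet {z : E × E | g z.1 = g z.2} := by
      have : {z : E × E | g z.1 = g z.2} = ⋃ i, (g ⁻¹' {i}) ×ˢ (g ⁻¹' {i}) := by
        ext z
        simp [eq_comm]
      rw [this]
      exact MeasurableSet.iUnion fun i =>
        (hg (measurableSet_singleton i)).prod (hg (measurableSet_singleton i))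
    rw [Measure.ae_sum_iff' hm]
    intro i
    refine Measure.ae_smul_measure ?_ _
    rw [Measure.prod_restrict]
    filter_upwards [ae_restrict_mem
      ((hg (measurableSet_singleton i)).prod (hg (measurableSet_singleton i)))] with z hz
    rw [hz.1, hz.2]

theorem residual_le {g : E → ι} (hg : Measurable g) (μ ν : Measure E) : residual g μ ν ≤ μ := by
  conv_rhs => rw [← sum_add_residual hg μ ν]
  exact Measure.le_add_left le_rfl

theorem lintegral_fiber {g : E → ι} (hg : Measurable g) (μ : Measure E) (v : ι → ℝ≥0∞) :
    ∫⁻ y, v (g y) ∂μ = ∑' i, v i * μ (g ⁻¹' {i}) := by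
  have hv : Measurable v := Measurable.of_discrete
  rw [← lintegral_map hv hg, lintegral_countable']
  simp_rw [Measure.map_apply hg (measurableSet_singleton _)]

/-- Coupling along a nested sequence of partitions, finest level first. -/
theorem exists_multilevel_coupling [PseudoEMetricSpace E] [OpensMeasurableSpace E]
    {p : ℝ} {G : Set E} {V : E → ℝ≥0∞}
    {v : ι → ℝ≥0∞} {g : ℕ → E → ι} (hg : ∀ l, Measurable (g l)) {u : ℕ → ℝ≥0∞} (L : ℕ)
    (hV : ∀ l ≤ L, ∀ y, v (g l y) = V y)
    (hnest : ∀ l < L, ∃ ψ : ι → ι, g l = ψ ∘ g (l + 1))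
    (hdiam : ∀ l ≤ L, ∀ x ∈ G, ∀ y ∈ G, g l x = g l y → edist x y ^ p ≤ u l * V x) :
    ∀ (μ ν : Measure E) [IsFiniteMeasure μ] [IsFiniteMeasure ν],
    (∀ᵐ y ∂μ, y ∈ G) → (∀ᵐ y ∂ν, y ∈ G) →
    ∃ (π : Measure (E × E)) (μ' ν' : Measure E), π.fst + μ' = μ ∧ π.snd + ν' = ν ∧
      (∀ i, μ' (g 0 ⁻¹' {i}) = μ (g 0 ⁻¹' {i}) - ν (g 0 ⁻¹' {i})) ∧
      (∀ i, ν' (g 0 ⁻¹' {i}) = ν (g 0 ⁻¹' {i}) - μ (g 0 ⁻¹' {i})) ∧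
      ∫⁻ z, edist z.1 z.2 ^ p ∂π ≤ u L * ∫⁻ y, V y ∂μ +
        ∑ l ∈ Finset.range L, u l * ∑' i, v i *
          (μ (g (l + 1) ⁻¹' {i}) - ν (g (l + 1) ⁻¹' {i})) := by
  have hVm : ∀ l ≤ L, Measurable V := by
    intro l hl
    have : V = v ∘ g l := by
      ext y
      exact (hV l hl y).symm
    rw [this]
    exact (Measurable.of_discrete (f := v)).comp (hg l)
  have step : ∀ l ≤ L, ∀ (μ ν : Measure E) [IsFiniteMeasure μ] [IsFiniteMeasure ν],
      (∀ᵐ y ∂μ, y ∈ G) → (∀ᵐ y ∂ν, y ∈ G) →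
      ∀ π : Measure (E × E), π.fst ≤ μ → π.snd ≤ ν → (∀ᵐ z ∂π, g l z.1 = g l z.2) →
      ∫⁻ z, edist z.1 z.2 ^ p ∂π ≤ u l * ∫⁻ y, V y ∂μ := by
    intro l hl μ ν _ _ hμ hν π h1 h2 h3
    have a1 : ∀ᵐ z ∂π, z.1 ∈ G :=
      ae_of_ae_map measurable_fst.aemeasurable (Measure.absolutelyContinuous_of_le h1 hμ)
    have a2 : ∀ᵐ z ∂π, z.2 ∈ G :=
      ae_of_ae_map measurable_snd.aemeasurable (Measure.absolutelyContinuous_of_le h2 hν)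
    calc ∫⁻ z, edist z.1 z.2 ^ p ∂π ≤ ∫⁻ z, u l * V z.1 ∂π := by
          refine lintegral_mono_ae ?_
          filter_upwards [a1, a2, h3] with z z1 z2 z3 using hdiam l hl _ z1 _ z2 z3
      _ = u l * ∫⁻ y, V y ∂π.fst := by
          rw [lintegral_const_mul (u l) (f := fun z : E × E => V z.1)
            ((hVm l hl).comp measurable_fst), Measure.fst,
            lintegral_map (hVm l hl) measurable_fst]
      _ ≤ _ := by
          gcongr
  induction L with
  | zero =>
    intro μ ν _ _ hμ hν
    obtain ⟨π, h1, h2, h3⟩ := exists_partial_coupling (hg 0) μ ν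
    refine ⟨π, _, _, h1, h2, residual_apply (hg 0) μ ν, residual_apply (hg 0) ν μ, ?_⟩
    rw [Finset.range_zero, Finset.sum_empty, add_zero]
    refine step 0 le_rfl μ ν hμ hν π ?_ ?_ h3
    · conv_rhs => rw [← h1]
      exact Measure.le_add_right le_rfl
    · conv_rhs => rw [← h2]
      exact Measure.le_add_right le_rfl
  | succ L ih =>
    intro μ ν _ _ hμ hν
    obtain ⟨π, h1, h2, h3⟩ := exists_partial_coupling (hg (L + 1)) μ ν
    have hπ1 : π.fst ≤ μ := by
      conv_rhs => rw [← h1]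
      exact Measure.le_add_right le_rfl
    have hπ2 : π.snd ≤ ν := by
      conv_rhs => rw [← h2]
      exact Measure.le_add_right le_rfl
    have hr1 := residual_le (hg (L + 1)) μ ν
    have hr2 := residual_le (hg (L + 1)) ν μ
    have : IsFiniteMeasure (residual (g (L + 1)) μ ν) := isFiniteMeasure_of_le μ hr1
    have : IsFiniteMeasure (residual (g (L + 1)) ν μ) := isFiniteMeasure_of_le ν hr2
    -- Coarser labels are functions of the finest one, so mass matched in a finest cell never leaves
    -- the coarser cell around it.
    have hcell : ∀ l ≤ L + 1, ∀ i, π.fst (g l ⁻¹' {i}) = π.snd (g l ⁻¹' {i}) := by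
      intro l hl i
      have hfac : ∃ ψ : ι → ι, g l = ψ ∘ g (L + 1) := by
        induction hl using Nat.decreasingInduction with
        | self => exact ⟨id, rfl⟩
        | of_succ k hk ihk =>
          obtain ⟨ψ, hψ⟩ := ihk
          obtain ⟨φ, hφ⟩ := hnest k hk
          exact ⟨φ ∘ ψ, by rw [hφ, hψ]; rfl⟩
      obtain ⟨ψ, hψ⟩ := hfac
      have hm := hg l (measurableSet_singleton i)
      rw [Measure.fst_apply hm, Measure.snd_apply hm]
      refine measure_congr ?_
      filter_upwards [h3] with z hz
      refine propext ?_
      change g l z.1 = i ↔ g l z.2 = i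
      rw [hψ, Function.comp_apply, Function.comp_apply, hz]
    -- Hence both measures lose the same finite mass in every coarser cell, and the differences seen
    -- by the remaining levels are the original ones.
    have hd : ∀ l ≤ L + 1, ∀ i, residual (g (L + 1)) μ ν (g l ⁻¹' {i}) -
        residual (g (L + 1)) ν μ (g l ⁻¹' {i}) = μ (g l ⁻¹' {i}) - ν (g l ⁻¹' {i}) ∧
        residual (g (L + 1)) ν μ (g l ⁻¹' {i}) -
        residual (g (L + 1)) μ ν (g l ⁻¹' {i}) = ν (g l ⁻¹' {i}) - μ (g l ⁻¹' {i}) := by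
      intro l hl i
      have e1 := congrArg (fun m : Measure E => m (g l ⁻¹' {i})) h1
      have e2 := congrArg (fun m : Measure E => m (g l ⁻¹' {i})) h2
      simp only [Measure.add_apply] at e1 e2
      have hfin : π.snd (g l ⁻¹' {i}) ≠ ∞ :=
        ne_top_of_le_ne_top (measure_ne_top ν _) (hπ2 _)
      rw [hcell l hl i] at e1
      rw [← e1, ← e2]
      exact ⟨(ENNReal.add_sub_add_eq_sub_left hfin).symm,
        (ENNReal.add_sub_add_eq_sub_left hfin).symm⟩
    obtain ⟨π', μ', ν', k1, k2, k3, k4, k5⟩ := ih (fun l hl => hV l (by omega))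
      (fun l hl => hnest l (by omega)) (fun l hl => hdiam l (by omega))
      (fun l hl => hVm l (by omega)) (fun l hl => step l (by omega))
      (residual (g (L + 1)) μ ν) (residual (g (L + 1)) ν μ)
      (Measure.absolutelyContinuous_of_le hr1 hμ) (Measure.absolutelyContinuous_of_le hr2 hν)
    refine ⟨π + π', μ', ν', ?_, ?_, ?_, ?_, ?_⟩
    · rw [Measure.fst_add, add_assoc, k1, h1]
    · rw [Measure.snd_add, add_assoc, k2, h2]
    · intro i
      rw [k3, (hd 0 (by omega) i).1]
    · intro i
      rw [k4, (hd 0 (by omega) i).2]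
    · rw [lintegral_add_measure]
      refine add_le_add (step (L + 1) le_rfl μ ν hμ hν π hπ1 hπ2 h3) (k5.trans ?_)
      rw [Finset.sum_range_succ, add_comm]
      refine add_le_add (le_of_eq (Finset.sum_congr rfl fun l hl => ?_)) (le_of_eq ?_)
      · congr 2
        ext1 i
        rw [(hd (l + 1) (by have := Finset.mem_range.1 hl; omega) i).1]
      -- What reaches level `L` is the excess left by level `L + 1`: this is why `u l` multiplies
      -- the differences of level `l + 1`.
      · have : V = fun y => v (g (L + 1) y) := by
          ext y
          exact (hV (L + 1) le_rfl y).symm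
        rw [this, lintegral_fiber (hg (L + 1))]
        congr 2
        ext1 i
        rw [residual_apply (hg (L + 1))]

end Coupling

/-- The distance `|a - b|` between two extended nonnegative reals. -/
noncomputable def absDiff (a b : ℝ≥0∞) : ℝ≥0∞ := (a - b) + (b - a)

/-! ### Transport cost bounded by discrepancies on the cells. -/

section Bound

variable {E ι : Type*} [MetricSpace E] [MeasurableSpace E] [BorelSpace E]
  [Countable ι] [MeasurableSpace ι] [MeasurableSingletonClass ι]

/-- Multiscale bound on the transport cost along a nested sequence of labelled partitions. -/
theorem wassersteinPow_le_of_labels {p : ℝ} (hp : 1 ≤ p) {x₀ : E} {G : Set E} {V : E → ℝ≥0∞}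
    {v : ι → ℝ≥0∞} {g : ℕ → E → ι} (hg : ∀ l, Measurable (g l)) (L : ℕ)
    (hV : ∀ l ≤ L, ∀ y, v (g l y) = V y)
    (hnest : ∀ l < L, ∃ ψ : ι → ι, g l = ψ ∘ g (l + 1))
    (hdiam : ∀ l ≤ L, ∀ x ∈ G, ∀ y ∈ G, g l x = g l y →
      edist x y ^ p ≤ 4 ^ p * (2 ^ (-p)) ^ l * V x)
    (hx₀ : ∀ y, edist x₀ y ^ p ≤ V y)
    (μ ν : Measure E) [IsProbabilityMeasure μ] [IsProbabilityMeasure ν]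
    (hμ : ∀ᵐ y ∂μ, y ∈ G) (hν : ∀ᵐ y ∂ν, y ∈ G) :
    wassersteinPow p μ ν ≤ 8 ^ p * ((2 ^ (-p)) ^ L * ∫⁻ y, V y ∂μ +
      ∑ l ∈ Finset.range (L + 1), (2 ^ (-p)) ^ l * ∑' i, v i *
        absDiff (μ (g l ⁻¹' {i})) (ν (g l ⁻¹' {i}))) := by
  have hp0 : 0 ≤ p := by linarith
  obtain ⟨π, μ', ν', h1, h2, h3, h4, h5⟩ :=
    exists_multilevel_coupling hg L hV hnest hdiam μ ν hμ hν
  have hμ' : μ' ≤ μ := by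
    conv_rhs => rw [← h1]
    exact Measure.le_add_left le_rfl
  have hν' : ν' ≤ ν := by
    conv_rhs => rw [← h2]
    exact Measure.le_add_left le_rfl
  have : IsFiniteMeasure μ' := isFiniteMeasure_of_le μ hμ'
  have : IsFiniteMeasure ν' := isFiniteMeasure_of_le ν hν'
  have huniv : μ' univ = ν' univ := by
    have e1 := congrArg (fun m : Measure E => m univ) h1
    have e2 := congrArg (fun m : Measure E => m univ) h2
    simp only [Measure.add_apply, measure_univ, Measure.fst_univ, Measure.snd_univ] at e1 e2
    have hfin : π univ ≠ ∞ := by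
      intro h
      rw [h, top_add] at e1
      exact ENNReal.top_ne_one e1
    exact (ENNReal.add_right_inj hfin).1 (e1.trans e2.symm)
  -- The leftovers of level 0 have equal total mass, so the partition with a single cell couples
  -- them without residual.
  obtain ⟨π₀, k1, k2, -⟩ := exists_partial_coupling (g := fun _ : E => ()) measurable_const μ' ν'
  have hres : ∀ a b : Measure E, IsFiniteMeasure a → IsFiniteMeasure b → a univ = b univ →
      residual (fun _ : E => ()) a b = 0 := by
    intro a b _ _ hab
    have := residual_apply (g := fun _ : E => ()) measurable_const a b ()
    have hu : (fun _ : E => ()) ⁻¹' {()} = univ := by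
      ext
      simp
    rw [hu, hab, tsub_self] at this
    exact Measure.measure_univ_eq_zero.1 this
  rw [hres μ' ν' inferInstance inferInstance huniv, add_zero] at k1
  rw [hres ν' μ' inferInstance inferInstance huniv.symm, add_zero] at k2
  have hm1 : (π + π₀).fst = μ := by rw [Measure.fst_add, k1, h1]
  have hm2 : (π + π₀).snd = ν := by rw [Measure.snd_add, k2, h2]
  have hprob : IsProbabilityMeasure (π + π₀) :=
    ⟨by rw [← Measure.fst_univ, hm1, measure_univ]⟩
  have hVm : Measurable V := by
    have : V = v ∘ g 0 := by
      ext y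
      exact (hV 0 (Nat.zero_le _) y).symm
    rw [this]
    exact (Measurable.of_discrete (f := v)).comp (hg 0)
  have hV0 : V = fun y => v (g 0 y) := by
    ext y
    exact (hV 0 (Nat.zero_le _) y).symm
  -- This last transport passes through `x₀`, and the weight `V` dominates the distance to `x₀` to
  -- the power `p`.
  have hlast : ∫⁻ z, edist z.1 z.2 ^ p ∂π₀ ≤ 8 ^ p * ∑' i, v i *
      absDiff (μ (g 0 ⁻¹' {i})) (ν (g 0 ⁻¹' {i})) := by
    calc ∫⁻ z, edist z.1 z.2 ^ p ∂π₀
        ≤ ∫⁻ z, 8 ^ p * (V z.1 + V z.2) ∂π₀ := by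
          refine lintegral_mono fun z => ?_
          calc edist z.1 z.2 ^ p ≤ (edist x₀ z.1 + edist x₀ z.2) ^ p := by
                gcongr
                rw [edist_comm x₀ z.1]
                exact edist_triangle _ _ _
            _ ≤ 2 ^ (p - 1) * (edist x₀ z.1 ^ p + edist x₀ z.2 ^ p) :=
                ENNReal.rpow_add_le_mul_rpow_add_rpow _ _ hp
            _ ≤ 8 ^ p * (V z.1 + V z.2) := by
                gcongr
                · calc (2 : ℝ≥0∞) ^ (p - 1) ≤ 2 ^ p :=
                        ENNReal.rpow_le_rpow_of_exponent_le (by norm_num) (by linarith)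
                    _ ≤ 8 ^ p := ENNReal.rpow_le_rpow (by norm_num) hp0
                · exact hx₀ _
                · exact hx₀ _
      _ = 8 ^ p * (∫⁻ y, V y ∂μ' + ∫⁻ y, V y ∂ν') := by
          have m1 : Measurable fun z : E × E => V z.1 := hVm.comp measurable_fst
          have m2 : Measurable fun z : E × E => V z.2 := hVm.comp measurable_snd
          rw [lintegral_const_mul (8 ^ p) (f := fun z : E × E => V z.1 + V z.2) (m1.add m2),
            lintegral_add_left m1, ← k1, ← k2, Measure.fst,
            Measure.snd, lintegral_map hVm measurable_fst, lintegral_map hVm measurable_snd]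
      _ = _ := by
          rw [hV0, lintegral_fiber (hg 0), lintegral_fiber (hg 0), ← ENNReal.tsum_add]
          congr 2
          ext1 i
          rw [h3, h4, ← mul_add, absDiff]
  -- Moving the index from `l` to `l + 1` costs a factor `2 ^ p`, whence `8 ^ p` in place of `4 ^
  -- p`.
  have h84 : ∀ l : ℕ, (4 : ℝ≥0∞) ^ p * (2 ^ (-p)) ^ l = 8 ^ p * (2 ^ (-p)) ^ (l + 1) := by
    intro l
    have : (8 : ℝ≥0∞) ^ p * 2 ^ (-p) = 4 ^ p := by
      rw [show (8 : ℝ≥0∞) = 4 * 2 by norm_num, ENNReal.mul_rpow_of_nonneg _ _ hp0, mul_assoc,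
        ← ENNReal.rpow_add _ _ (by norm_num) (by norm_num), add_neg_cancel, ENNReal.rpow_zero,
        mul_one]
    rw [pow_succ', ← mul_assoc, this]
  calc wassersteinPow p μ ν ≤ ∫⁻ z, edist z.1 z.2 ^ p ∂(π + π₀) :=
        iInf₂_le (π + π₀) ⟨hprob, hm1, hm2⟩
    _ = ∫⁻ z, edist z.1 z.2 ^ p ∂π + ∫⁻ z, edist z.1 z.2 ^ p ∂π₀ := lintegral_add_measure _ _ _
    _ ≤ (4 ^ p * (2 ^ (-p)) ^ L * ∫⁻ y, V y ∂μ +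
        ∑ l ∈ Finset.range L, 4 ^ p * (2 ^ (-p)) ^ l * ∑' i, v i *
          (μ (g (l + 1) ⁻¹' {i}) - ν (g (l + 1) ⁻¹' {i}))) +
        8 ^ p * ∑' i, v i * absDiff (μ (g 0 ⁻¹' {i})) (ν (g 0 ⁻¹' {i})) := add_le_add h5 hlast
    _ ≤ (8 ^ p * (2 ^ (-p)) ^ L * ∫⁻ y, V y ∂μ +
        ∑ l ∈ Finset.range L, 8 ^ p * (2 ^ (-p)) ^ (l + 1) * ∑' i, v i *
          absDiff (μ (g (l + 1) ⁻¹' {i})) (ν (g (l + 1) ⁻¹' {i}))) +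
        8 ^ p * ∑' i, v i * absDiff (μ (g 0 ⁻¹' {i})) (ν (g 0 ⁻¹' {i})) := by
        refine add_le_add (add_le_add ?_ (Finset.sum_le_sum fun l _ => ?_)) le_rfl
        · gcongr
          norm_num
        · rw [h84]
          gcongr
          exact le_self_add
    _ = _ := by
        rw [Finset.sum_range_succ']
        simp only [pow_zero, one_mul, mul_add, Finset.mul_sum, mul_assoc, add_assoc]

end Bound

/-! ### Dyadic shells around the center. -/

section Shells

variable {E : Type*} [MetricSpace E]

/-- The radius of the dyadic shell `k`; the shell `none` is the center alone. -/
noncomputable def shellRadius : Option ℤ → ℝ≥0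
  | none => 0
  | some k => 2 ^ k

open scoped Classical in
/-- The index of the dyadic shell around `x₀` that contains `y`. -/
noncomputable def shell (x₀ y : E) : Option ℤ :=
  if y = x₀ then none else some (Int.clog 2 (dist x₀ y))

theorem shell_eq_some_iff {x₀ y : E} {k : ℤ} :
    shell x₀ y = some k ↔ (2 : ℝ) ^ (k - 1) < dist x₀ y ∧ dist x₀ y ≤ 2 ^ k := by
  unfold shell
  split_ifs with h
  · subst h
    simp only [dist_self, false_iff, not_and]
    intro h
    exact absurd h (not_lt.2 (by positivity))
  · have hd : 0 < dist x₀ y := dist_pos.2 (Ne.symm h)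
    have h1 := Int.self_le_zpow_clog (b := 2) one_lt_two (dist x₀ y)
    have h2 := Int.zpow_pred_clog_lt_self (b := 2) one_lt_two hd
    rw [Option.some_inj]
    constructor
    · rintro rfl
      exact_mod_cast And.intro h2 h1
    · rintro ⟨h3, h4⟩
      push_cast at h1 h2
      have a := (zpow_lt_zpow_iff_right₀ (one_lt_two (α := ℝ))).1 (h3.trans_le h1)
      have b := (zpow_lt_zpow_iff_right₀ (one_lt_two (α := ℝ))).1 (h2.trans_le h4)
      omega

theorem shell_eq_none_iff {x₀ y : E} : shell x₀ y = none ↔ y = x₀ := by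
  unfold shell
  split_ifs with h <;> simp [h]

theorem dist_le_shellRadius (x₀ y : E) : dist x₀ y ≤ shellRadius (shell x₀ y) := by
  rcases h : shell x₀ y with _ | k
  · rw [shell_eq_none_iff.1 h]
    simp
  · simpa [shellRadius] using (shell_eq_some_iff.1 h).2

theorem shellRadius_le_two_mul_dist (x₀ y : E) :
    (shellRadius (shell x₀ y) : ℝ) ≤ 2 * dist x₀ y := by
  rcases h : shell x₀ y with _ | k
  · simp [shellRadius]
  · have := (shell_eq_some_iff.1 h).1
    rw [zpow_sub_one₀ two_ne_zero] at this
    simp only [shellRadius, NNReal.coe_zpow, NNReal.coe_ofNat]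
    linarith

instance : MeasurableSpace (Option ℤ) := ⊤

instance : DiscreteMeasurableSpace (Option ℤ) := ⟨fun _ => trivial⟩

theorem measurable_shell [MeasurableSpace E] [BorelSpace E] (x₀ : E) :
    Measurable (shell x₀) := by
  refine measurable_to_countable' fun k => ?_
  rcases k with _ | k
  · have : shell x₀ ⁻¹' {none} = {x₀} := by
      ext y
      exact shell_eq_none_iff
    rw [this]
    exact measurableSet_singleton x₀
  · have : shell x₀ ⁻¹' {some k} =
        {y | (2 : ℝ) ^ (k - 1) < dist x₀ y} ∩ {y | dist x₀ y ≤ 2 ^ k} := by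
      ext y
      exact shell_eq_some_iff
    rw [this]
    have hc : Continuous fun y => dist x₀ y := by fun_prop
    exact ((isOpen_lt continuous_const hc).measurableSet).inter
      (isClosed_le hc continuous_const).measurableSet

end Shells

/-! ### Nets of the shells from the covering condition. -/

section Nets

variable {E : Type*} [MetricSpace E]

theorem exists_enum_of_card_le {X : Type*} {s : Finset X} (hs : s.Nonempty) {N : ℕ}
    (hN : s.card ≤ N) : ∃ e : ℕ → X, (∀ j, e j ∈ s) ∧ ∀ y ∈ s, ∃ j < N, e j = y := by
  obtain ⟨x, hx⟩ := hs
  refine ⟨fun j => if h : j < s.card then (s.equivFin.symm ⟨j, h⟩ : X) else x, fun j => ?_,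
    fun y hy => ⟨s.equivFin ⟨y, hy⟩, (Fin.is_lt _).trans_le hN, ?_⟩⟩
  · dsimp only
    split_ifs
    · exact Finset.coe_mem _
    · exact hx
  · simp

/-- The number of points of a net at level `l`. -/
noncomputable def netCard (α β : ℝ) (l : ℕ) : ℕ := ⌊β * (2 ^ (l + 1)) ^ α⌋₊ + 1

/-- The ratio of diameter to resolution is `2 ^ (l + 1)` in every shell, so the size of the net
depends on `l` only. The point `x₀`, which need not lie in `S`, is added so that the net is nonempty
even when `S` misses the ball; this is the extra unit in `netCard`. -/
theorem exists_net {S : Set E} {x₀ : E} {α β : ℝ} (h : UniformCovering S x₀ α β)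
    (k : Option ℤ) (l : ℕ) :
    ∃ e : ℕ → E, (∀ j, e j ∈ insert x₀ (S ∩ closedBall x₀ (shellRadius k))) ∧
      ∀ y ∈ insert x₀ (S ∩ closedBall x₀ (shellRadius k)),
        ∃ j < netCard α β l, dist y (e j) ≤ shellRadius k * (1 / 2) ^ l := by
  classical
  rcases k with _ | k
  · refine ⟨fun _ => x₀, fun _ => mem_insert _ _, fun y hy => ⟨0, Nat.succ_pos _, ?_⟩⟩
    rcases hy with rfl | hy
    · simp [shellRadius]
    · simpa [shellRadius] using hy.2
  · have hr : (0 : ℝ≥0) < 2 ^ k := by positivity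
    have hδ : (0 : ℝ≥0) < 2 ^ k * (1 / 2) ^ l := by positivity
    have hle : ((2 ^ k * (1 / 2) ^ l : ℝ≥0) : ℝ) ≤ 2 * ((2 : ℝ) ^ k) := by
      push_cast
      have : ((1 : ℝ) / 2) ^ l ≤ 1 := pow_le_one₀ (by norm_num) (by norm_num)
      have h2 : (0 : ℝ) < 2 ^ k := by positivity
      nlinarith
    have hc := h (2 ^ k) (2 ^ k * (1 / 2) ^ l) (by positivity) hδ hle
    have hrat : 2 * (2 : ℝ) ^ k / ((2 ^ k * (1 / 2) ^ l : ℝ≥0) : ℝ) = 2 ^ (l + 1) := by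
      push_cast
      have h2 : (2 : ℝ) ^ k ≠ 0 := by positivity
      rw [one_div, inv_pow]
      field_simp
      ring
    rw [hrat] at hc
    have hfin : coveringNumber (2 ^ k * (1 / 2) ^ l : ℝ≥0) (S ∩ closedBall x₀ (2 ^ k)) ≠ ⊤ := by
      intro htop
      rw [htop] at hc
      simp at hc
    obtain ⟨C, hCs, hCf, hCc, hCe⟩ := exists_set_encard_eq_coveringNumber hfin
    have hcard : hCf.toFinset.card ≤ ⌊β * (2 ^ (l + 1)) ^ α⌋₊ := by
      rw [← hCe, hCf.encard_eq_coe_toFinset_card] at hc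
      have h3 : ((hCf.toFinset.card : ℕ) : ℝ≥0∞) ≤ ENNReal.ofReal (β * (2 ^ (l + 1)) ^ α) := by
        simpa using hc
      rcases Nat.eq_zero_or_pos hCf.toFinset.card with h0 | h0
      · rw [h0]
        exact Nat.zero_le _
      · exact Nat.le_floor ((ENNReal.natCast_le_ofReal h0.ne').1 h3)
    obtain ⟨e, he1, he2⟩ := exists_enum_of_card_le (s := insert x₀ hCf.toFinset)
      (Finset.insert_nonempty _ _) (N := netCard α β l)
      ((Finset.card_insert_le _ _).trans (Nat.succ_le_succ hcard))
    have hsr : ((shellRadius (some k) : ℝ≥0) : ℝ) = 2 ^ k := by simp [shellRadius]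
    rw [hsr]
    refine ⟨e, fun j => ?_, fun y hy => ?_⟩
    · have := he1 j
      rw [Finset.mem_insert, Finite.mem_toFinset] at this
      exact this.imp id fun hj => hCs hj
    · rcases hy with rfl | hy
      · obtain ⟨j, hj, hj2⟩ := he2 y (Finset.mem_insert_self _ _)
        refine ⟨j, hj, ?_⟩
        rw [hj2, dist_self]
        positivity
      · obtain ⟨c, hc1, hc2⟩ := hCc hy
        obtain ⟨j, hj, hj2⟩ := he2 c (Finset.mem_insert_of_mem (hCf.mem_toFinset.2 hc1))
        refine ⟨j, hj, ?_⟩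
        rw [hj2]
        have hc3 : edist y c ≤ ((2 ^ k * (1 / 2) ^ l : ℝ≥0) : ℝ≥0∞) := hc2
        rw [edist_nndist, ENNReal.coe_le_coe] at hc3
        have : dist y c ≤ ((2 ^ k * (1 / 2) ^ l : ℝ≥0) : ℝ) := by
          rw [dist_nndist]
          exact_mod_cast hc3
        simpa using this

end Nets

/-! ### Nested labels and the deterministic multiscale bound. -/

section Labels

variable {E : Type*} [MetricSpace E]

open scoped Classical in
/-- The index of the first point among `e 0, …, e (N - 1)` at distance at most `r` from `y`, and
`N` if there is none. -/
noncomputable def firstNear (e : ℕ → E) (N : ℕ) (r : ℝ) (y : E) : ℕ :=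
  Nat.find (p := fun j => dist y (e j) ≤ r ∨ N ≤ j) ⟨N, Or.inr le_rfl⟩

theorem firstNear_le (e : ℕ → E) (N : ℕ) (r : ℝ) (y : E) : firstNear e N r y ≤ N := by
  classical
  exact Nat.find_min' _ (Or.inr le_rfl)

theorem firstNear_spec {e : ℕ → E} {N : ℕ} {r : ℝ} {y : E} (h : ∃ j < N, dist y (e j) ≤ r) :
    firstNear e N r y < N ∧ dist y (e (firstNear e N r y)) ≤ r := by
  classical
  obtain ⟨j, hj, hj2⟩ := h
  have h1 : firstNear e N r y ≤ j := Nat.find_min' _ (Or.inl hj2)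
  have h2 : dist y (e (firstNear e N r y)) ≤ r ∨ N ≤ firstNear e N r y :=
    Nat.find_spec (p := fun j => dist y (e j) ≤ r ∨ N ≤ j) _
  have h3 := h1.trans_lt hj
  exact ⟨h3, h2.resolve_right (not_le.2 h3)⟩

theorem measurable_firstNear [MeasurableSpace E] [BorelSpace E] (e : ℕ → E) (N : ℕ) (r : ℝ) :
    Measurable (firstNear e N r) := by
  classical
  refine measurable_find _ fun k => ?_
  exact MeasurableSet.union measurableSet_closedBall (MeasurableSet.const _)

/-- The label of `y` at level `l`, obtained from a label at level `l + m` by going up from each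
net to the next coarser one. -/
noncomputable def netLabel (e : ℕ → ℕ → E) (N : ℕ → ℕ) (r : ℕ → ℝ) : ℕ → ℕ → E → ℕ
  | l, 0, y => firstNear (e l) (N l) (r l) y
  | l, m + 1, y => firstNear (e l) (N l) (r l) (e (l + 1) (netLabel e N r (l + 1) m y))

theorem netLabel_le (e : ℕ → ℕ → E) (N : ℕ → ℕ) (r : ℕ → ℝ) (l m : ℕ) (y : E) :
    netLabel e N r l m y ≤ N l := by
  cases m <;> exact firstNear_le _ _ _ _

theorem measurable_netLabel [MeasurableSpace E] [BorelSpace E] (e : ℕ → ℕ → E) (N : ℕ → ℕ)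
    (r : ℕ → ℝ) (l m : ℕ) : Measurable (netLabel e N r l m) := by
  induction m generalizing l with
  | zero => exact measurable_firstNear _ _ _
  | succ m ih =>
    exact (Measurable.of_discrete (f := fun j => firstNear (e l) (N l) (r l) (e (l + 1) j))).comp
      (ih (l + 1))

/-- Writing `δ = R * (1 / 2) ^ l`, the error inherited from level `l + 1` is `2 * (δ / 2) = δ`, and
the step to the net of level `l` adds at most `δ`. The bound `2 * δ` therefore survives any number
of steps. -/
theorem netLabel_spec {e : ℕ → ℕ → E} {N : ℕ → ℕ} {R : ℝ} (hR : 0 ≤ R) {A : Set E}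
    (he : ∀ l j, e l j ∈ A) (hcov : ∀ l, ∀ y ∈ A, ∃ j < N l, dist y (e l j) ≤ R * (1 / 2) ^ l)
    (l m : ℕ) {y : E} (hy : y ∈ A) :
    dist y (e l (netLabel e N (fun l => R * (1 / 2) ^ l) l m y)) ≤ 2 * (R * (1 / 2) ^ l) := by
  induction m generalizing l with
  | zero =>
    have h := (firstNear_spec (hcov l y hy)).2
    have h0 : 0 ≤ R * (1 / 2) ^ l := by positivity
    simp only [netLabel]
    linarith
  | succ m ih =>
    have h1 := ih (l + 1)
    have h2 := (firstNear_spec (hcov l _ (he (l + 1)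
      (netLabel e N (fun l => R * (1 / 2) ^ l) (l + 1) m y)))).2
    rw [pow_succ] at h1
    simp only [netLabel]
    refine (dist_triangle _ _ _).trans ((add_le_add h1 h2).trans (le_of_eq ?_))
    ring

/-- Nested labelled partitions, refining the dyadic shells, whose cells at level `l` have
diameter of order `2 ^ (-l)` relative to the radius of their shell. -/
theorem exists_nested_labels [MeasurableSpace E] [BorelSpace E] {S : Set E} {x₀ : E} {α β : ℝ}
    (h : UniformCovering S x₀ α β) (L : ℕ) :
    ∃ g : ℕ → E → Option ℤ × ℕ, (∀ l, Measurable (g l)) ∧ (∀ l y, (g l y).1 = shell x₀ y) ∧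
      (∀ l y, (g l y).2 ≤ netCard α β l) ∧ (∀ l < L, ∃ ψ, g l = ψ ∘ g (l + 1)) ∧
      ∀ l, ∀ x ∈ S, ∀ y ∈ S, g l x = g l y →
        dist x y ≤ 4 * (shellRadius (shell x₀ x) * (1 / 2) ^ l) := by
  choose e he hcov using exists_net h
  set N := netCard α β
  let lab : Option ℤ → ℕ → ℕ → E → ℕ := fun k =>
    netLabel (e k) N (fun l => shellRadius k * (1 / 2) ^ l)
  -- All labels up to `L` descend from the net of level `L`, which forces nesting. Past `L` the
  -- truncated difference `L - l` is `0`; nesting is not claimed there.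
  refine ⟨fun l y => (shell x₀ y, lab (shell x₀ y) l (L - l) y), fun l => ?_, fun _ _ => rfl,
    fun l y => netLabel_le _ _ _ _ _ _, fun l hl => ?_, fun l x hx y hy hxy => ?_⟩
  · refine (measurable_shell x₀).prodMk ?_
    have hm : Measurable fun z : E × Option ℤ => lab z.2 l (L - l) z.1 :=
      measurable_from_prod_countable_left fun k =>
        measurable_netLabel (e k) N (fun l => shellRadius k * (1 / 2) ^ l) l (L - l)
    exact hm.comp (measurable_id.prodMk (measurable_shell x₀))
  · refine ⟨fun i => (i.1, firstNear (e i.1 l) (N l) (shellRadius i.1 * (1 / 2) ^ l)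
      (e i.1 (l + 1) i.2)), ?_⟩
    ext1 y
    have : L - l = (L - (l + 1)) + 1 := by omega
    simp only [Function.comp_apply]
    rw [this]
    rfl
  · obtain ⟨h1, h2⟩ := Prod.mk.inj hxy
    have hmem : ∀ z ∈ S, z ∈ insert x₀ (S ∩ closedBall x₀ (shellRadius (shell x₀ z))) := by
      intro z hz
      refine mem_insert_of_mem _ ⟨hz, ?_⟩
      rw [mem_closedBall, dist_comm]
      exact dist_le_shellRadius x₀ z
    have a1 := netLabel_spec (NNReal.coe_nonneg _) (he (shell x₀ x)) (hcov (shell x₀ x)) l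
      (L - l) (hmem x hx)
    have a2 := netLabel_spec (NNReal.coe_nonneg _) (he (shell x₀ y)) (hcov (shell x₀ y)) l
      (L - l) (hmem y hy)
    simp only [lab] at h2
    rw [← h1] at h2 a2
    rw [h2] at a1
    refine (dist_triangle_right _ _ _).trans ((add_le_add a1 a2).trans (le_of_eq ?_))
    ring

/-- Deterministic multiscale bound for the transport cost between two probability measures
carried by `S`. -/
theorem exists_cells [MeasurableSpace E] [BorelSpace E] {S : Set E} {x₀ : E} {α β p : ℝ}
    (hp : 1 ≤ p) (h : UniformCovering S x₀ α β) (L : ℕ) :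
    ∃ g : ℕ → E → Option ℤ × ℕ, (∀ l, Measurable (g l)) ∧ (∀ l y, (g l y).1 = shell x₀ y) ∧
      (∀ l y, (g l y).2 ≤ netCard α β l) ∧
      ∀ (μ ν : Measure E) [IsProbabilityMeasure μ] [IsProbabilityMeasure ν],
        (∀ᵐ y ∂μ, y ∈ S) → (∀ᵐ y ∂ν, y ∈ S) →
        wassersteinPow p μ ν ≤
          8 ^ p * ((2 ^ (-p)) ^ L * ∫⁻ y, (shellRadius (shell x₀ y) : ℝ≥0∞) ^ p ∂μ +
          ∑ l ∈ Finset.range (L + 1), (2 ^ (-p)) ^ l * ∑' i : Option ℤ × ℕ,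
            (shellRadius i.1 : ℝ≥0∞) ^ p *
            absDiff (μ (g l ⁻¹' {i})) (ν (g l ⁻¹' {i}))) := by
  obtain ⟨g, hg, hs, hN, hnest, hd⟩ := exists_nested_labels h L
  have hp0 : 0 ≤ p := by linarith
  refine ⟨g, hg, hs, hN, fun μ ν _ _ hμ hν => ?_⟩
  refine wassersteinPow_le_of_labels hp (x₀ := x₀) (G := S)
    (V := fun y => (shellRadius (shell x₀ y) : ℝ≥0∞) ^ p) (ι := Option ℤ × ℕ)
    (v := fun i => (shellRadius i.1 : ℝ≥0∞) ^ p)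
    hg L (fun l _ y => by rw [hs]) hnest (fun l _ x hx y hy hxy => ?_) (fun y => ?_) μ ν hμ hν
  · have h1 := hd l x hx y hy hxy
    have h2 : edist x y ≤ 4 * (shellRadius (shell x₀ x) * (2⁻¹) ^ l) := by
      rw [edist_dist]
      refine (ENNReal.ofReal_le_ofReal h1).trans (le_of_eq ?_)
      rw [ENNReal.ofReal_mul (by norm_num), ENNReal.ofReal_mul (by positivity),
        ENNReal.ofReal_pow (by norm_num), ENNReal.ofReal_coe_nnreal, one_div,
        ENNReal.ofReal_inv_of_pos (by norm_num), ENNReal.ofReal_ofNat, ENNReal.ofReal_ofNat]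
    calc edist x y ^ p ≤ (4 * (shellRadius (shell x₀ x) * (2⁻¹) ^ l)) ^ p := by gcongr
      _ = _ := by
        rw [ENNReal.mul_rpow_of_nonneg _ _ hp0, ENNReal.mul_rpow_of_nonneg _ _ hp0,
          ENNReal.rpow_neg, ← ENNReal.inv_rpow, ← ENNReal.rpow_natCast, ← ENNReal.rpow_natCast,
          ← ENNReal.rpow_mul, ← ENNReal.rpow_mul, mul_comm p, mul_assoc,
          mul_comm ((shellRadius (shell x₀ x) : ℝ≥0∞) ^ p)]
  · gcongr
    rw [edist_nndist]
    exact_mod_cast dist_le_shellRadius x₀ y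

end Labels

/-! ### Exponential moments and deviations of functions of independent variables. -/

section ExponentialMoment

/-- Second-order Taylor remainder. Keeping `u ^ 2` as a factor lets the second moment, rather than
the supremum, enter the exponential bound. -/
theorem exp_le_one_add_add_sq_mul (u : ℝ) :
    Real.exp u ≤ 1 + u + u ^ 2 * Real.exp |u| := by
  have h := Complex.norm_exp_sub_sum_le_norm_mul_exp (u : ℂ) 2
  have e : Complex.exp u - ∑ m ∈ Finset.range 2, (u : ℂ) ^ m / (m.factorial : ℂ) =
      ((Real.exp u - (1 + u) : ℝ) : ℂ) := by
    simp [Finset.sum_range_succ]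
  rw [e, Complex.norm_real, Complex.norm_real, Real.norm_eq_abs, Real.norm_eq_abs, sq_abs] at h
  have := le_abs_self (Real.exp u - (1 + u))
  linarith

variable {E : Type*} [MeasurableSpace E] {μ : Measure E} [IsProbabilityMeasure μ]

theorem integrable_of_abs_le {X : Type*} [MeasurableSpace X] {ρ : Measure X} [IsFiniteMeasure ρ]
    {f : X → ℝ} (hf : Measurable f) {K : ℝ} (hK : ∀ x, |f x| ≤ K) : Integrable f ρ :=
  Integrable.of_bound hf.aestronglyMeasurable K (ae_of_all _ hK)

theorem abs_exp_mul_le {s t K : ℝ} (hs : 0 ≤ s) (h : |t| ≤ K) :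
    |Real.exp (s * t)| ≤ Real.exp (s * K) := by
  rw [abs_of_pos (Real.exp_pos _)]
  exact Real.exp_le_exp.2 (mul_le_mul_of_nonneg_left ((le_abs_self t).trans h) hs)

/-- Exponential moment of a function of bounded oscillation. -/
theorem integral_exp_mul_le {g H : E → ℝ} (hg : Measurable g) (hH : Measurable H) {b s K : ℝ}
    (hs : 0 ≤ s) (hH0 : ∀ y, 0 ≤ H y) (hHb : ∀ y, H y ≤ b) (hK : ∀ y, |g y| ≤ K)
    (hd : ∀ y z, |g y - g z| ≤ H y + H z) :
    ∫ y, Real.exp (s * g y) ∂μ ≤ Real.exp (s * ∫ y, g y ∂μ) *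
      Real.exp (4 * s ^ 2 * Real.exp (2 * s * b) * ∫ y, H y ^ 2 ∂μ) := by
  have hHb' : ∀ y, |H y| ≤ b := fun y => by rw [abs_of_nonneg (hH0 y)]; exact hHb y
  have ig : Integrable g μ := integrable_of_abs_le hg hK
  have iH : Integrable H μ := integrable_of_abs_le hH hHb'
  have iH2 : Integrable (fun y => H y ^ 2) μ := by
    refine integrable_of_abs_le (hH.pow_const 2) (K := b ^ 2) fun y => ?_
    rw [abs_pow]
    exact pow_le_pow_left₀ (abs_nonneg _) (hHb' y) 2
  set m := ∫ y, g y ∂μ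
  set h := ∫ y, H y ∂μ
  have hh0 : 0 ≤ h := integral_nonneg hH0
  have hhb : h ≤ b := by
    calc h ≤ ∫ _, b ∂μ := integral_mono iH (integrable_const b) hHb
      _ = b := by simp
  -- Compare with an independent copy and average over it.
  have hgm : ∀ y, |g y - m| ≤ H y + h := by
    intro y
    have e : g y - m = ∫ z, (g y - g z) ∂μ := by
      rw [integral_sub (integrable_const _) ig]
      simp [m]
    rw [e]
    calc |∫ z, (g y - g z) ∂μ| ≤ ∫ z, |g y - g z| ∂μ := abs_integral_le_integral_abs
      _ ≤ ∫ z, (H y + H z) ∂μ :=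
        integral_mono ((integrable_const _).sub ig).abs ((integrable_const _).add iH) (hd y)
      _ = H y + h := by
        rw [integral_add (integrable_const _) iH]
        simp [h]
  have hsq : h ^ 2 ≤ ∫ y, H y ^ 2 ∂μ := by
    have h1 : 0 ≤ ∫ y, (H y - h) ^ 2 ∂μ := integral_nonneg fun y => sq_nonneg _
    have h2 : ∫ y, (H y - h) ^ 2 ∂μ = ∫ y, H y ^ 2 ∂μ - h ^ 2 := by
      have : (fun y => (H y - h) ^ 2) = fun y => H y ^ 2 - (2 * h * H y - h ^ 2) := by
        ext y
        ring
      have j1 : Integrable (fun y => 2 * h * H y) μ := iH.const_mul _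
      have j2 : Integrable (fun y => 2 * h * H y - h ^ 2) μ := j1.sub (integrable_const _)
      rw [this, integral_sub iH2 j2, integral_sub j1 (integrable_const _), integral_const_mul]
      simp only [integral_const, probReal_univ, smul_eq_mul, one_mul]
      change _ - (2 * h * h - h ^ 2) = _
      ring
    linarith
  set c := s ^ 2 * Real.exp (2 * s * b)
  have hc : 0 ≤ c := by positivity
  -- Here `|g - m| ≤ 2 * b` controls the exponential factor, and `(H + h) ^ 2 ≤ 2 * H ^ 2 + 2 * h ^
  -- 2` the square. Integration with `h ^ 2 ≤ ∫ H ^ 2` then produces the constant 4.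
  have hpt : ∀ y, Real.exp (s * (g y - m)) ≤
      1 + s * (g y - m) + c * (2 * H y ^ 2 + 2 * h ^ 2) := by
    intro y
    have h1 := exp_le_one_add_add_sq_mul (s * (g y - m))
    have h2 : |s * (g y - m)| ≤ 2 * s * b := by
      rw [abs_mul, abs_of_nonneg hs]
      have := (hgm y).trans (add_le_add (hHb y) hhb)
      nlinarith
    have h3 : (s * (g y - m)) ^ 2 ≤ s ^ 2 * (2 * H y ^ 2 + 2 * h ^ 2) := by
      rw [mul_pow]
      refine mul_le_mul_of_nonneg_left ?_ (sq_nonneg s)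
      have h4 : (g y - m) ^ 2 ≤ (H y + h) ^ 2 := sq_le_sq' (by linarith [abs_le.1 (hgm y)])
        (by linarith [abs_le.1 (hgm y)])
      nlinarith [sq_nonneg (H y - h)]
    have h5 := mul_le_mul h3 (Real.exp_le_exp.2 h2) (Real.exp_pos _).le (by positivity)
    calc _ ≤ _ := h1
      _ ≤ 1 + s * (g y - m) + s ^ 2 * (2 * H y ^ 2 + 2 * h ^ 2) * Real.exp (2 * s * b) := by
        linarith
      _ = _ := by simp only [c]; ring
  have iexp : Integrable (fun y => Real.exp (s * g y)) μ :=
    integrable_of_abs_le (hg.const_mul s).exp fun y => abs_exp_mul_le hs (hK y)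
  have e1 : ∀ y, Real.exp (s * (g y - m)) = Real.exp (s * g y) * Real.exp (-(s * m)) := by
    intro y
    rw [← Real.exp_add]
    ring_nf
  have i1 : Integrable (fun y => 1 + s * (g y - m)) μ :=
    (integrable_const _).add ((ig.sub (integrable_const _)).const_mul s)
  have i2 : Integrable (fun y => c * (2 * H y ^ 2 + 2 * h ^ 2)) μ :=
    ((iH2.const_mul 2).add (integrable_const _)).const_mul c
  have key : (∫ y, Real.exp (s * g y) ∂μ) * Real.exp (-(s * m)) ≤
      1 + 4 * c * ∫ y, H y ^ 2 ∂μ := by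
    rw [← integral_mul_const]
    calc ∫ y, Real.exp (s * g y) * Real.exp (-(s * m)) ∂μ
        ≤ ∫ y, (1 + s * (g y - m) + c * (2 * H y ^ 2 + 2 * h ^ 2)) ∂μ := by
          refine integral_mono (iexp.mul_const _) (i1.add i2) fun y => ?_
          dsimp only
          rw [← e1]
          exact hpt y
      _ = 1 + c * (2 * ∫ y, H y ^ 2 ∂μ + 2 * h ^ 2) := by
          have j1 : Integrable (fun y => g y - m) μ := ig.sub (integrable_const _)
          have j2 : Integrable (fun y => s * (g y - m)) μ := j1.const_mul s
          have j3 : Integrable (fun y => 2 * H y ^ 2) μ := iH2.const_mul 2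
          rw [integral_add i1 i2, integral_add (integrable_const _) j2, integral_const_mul,
            integral_const_mul, integral_sub ig (integrable_const _), integral_add j3
            (integrable_const _), integral_const_mul]
          simp [m]
      _ ≤ _ := by nlinarith
  have e2 : ∫ y, Real.exp (s * g y) ∂μ =
      Real.exp (s * m) * ((∫ y, Real.exp (s * g y) ∂μ) * Real.exp (-(s * m))) := by
    rw [mul_comm, mul_assoc, ← Real.exp_add, neg_add_cancel, Real.exp_zero, mul_one]
  rw [e2]
  refine mul_le_mul_of_nonneg_left (key.trans ?_) (Real.exp_pos _).le
  have := Real.add_one_le_exp (4 * c * ∫ y, H y ^ 2 ∂μ)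
  have e3 : 4 * s ^ 2 * Real.exp (2 * s * b) * ∫ y, H y ^ 2 ∂μ = 4 * c * ∫ y, H y ^ 2 ∂μ := by
    simp only [c]
    ring
  rw [e3]
  linarith

theorem piFinSuccAbove_symm_eq_cons {n : ℕ} (z : E × (Fin n → E)) :
    (MeasurableEquiv.piFinSuccAbove (fun _ : Fin (n + 1) => E) 0).symm z =
      Fin.cons z.1 z.2 := by
  simp [MeasurableEquiv.piFinSuccAbove, Fin.insertNthEquiv, Fin.insertNth_zero']

theorem integral_pi_succ {n : ℕ} {f : (Fin (n + 1) → E) → ℝ} (hf : Measurable f) {K : ℝ}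
    (hK : ∀ x, |f x| ≤ K) :
    ∫ x, f x ∂(Measure.pi fun _ : Fin (n + 1) => μ) =
      ∫ x, ∫ y, f (Fin.cons y x) ∂μ ∂(Measure.pi fun _ : Fin n => μ) := by
  have hmp := (measurePreserving_piFinSuccAbove (fun _ : Fin (n + 1) => μ) 0).symm
  rw [← hmp.integral_comp', integral_prod_symm]
  · simp_rw [piFinSuccAbove_symm_eq_cons]
  · exact integrable_of_abs_le (hf.comp (MeasurableEquiv.measurable _)) fun z => hK _

/-- Exponential moment of a function of independent variables, each of which has bounded
influence. -/
theorem integral_exp_mul_pi_le {H : E → ℝ} (hH : Measurable H) {b s : ℝ}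
    (hs : 0 ≤ s) (hH0 : ∀ y, 0 ≤ H y) (hHb : ∀ y, H y ≤ b) {K : ℝ} (n : ℕ) :
    ∀ φ : (Fin n → E) → ℝ, Measurable φ → (∀ x, |φ x| ≤ K) →
      (∀ x i z, |φ x - φ (Function.update x i z)| ≤ H (x i) + H z) →
      ∫ x, Real.exp (s * φ x) ∂(Measure.pi fun _ : Fin n => μ) ≤
        Real.exp (s * ∫ x, φ x ∂(Measure.pi fun _ : Fin n => μ)) *
        Real.exp (n * (4 * s ^ 2 * Real.exp (2 * s * b) * ∫ y, H y ^ 2 ∂μ)) := by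
  induction n with
  | zero =>
    intro φ _ _ _
    rw [Measure.pi_of_empty, integral_dirac, integral_dirac]
    simp
  | succ n ih =>
    intro φ hφ hK hd
    have hcons : Measurable fun z : E × (Fin n → E) => (Fin.cons z.1 z.2 : Fin (n + 1) → E) := by
      simp_rw [← piFinSuccAbove_symm_eq_cons]
      exact (MeasurableEquiv.piFinSuccAbove (fun _ : Fin (n + 1) => E) 0).symm.measurable
    have hΦ : Measurable fun z : E × (Fin n → E) => φ (Fin.cons z.1 z.2) := hφ.comp hcons
    have hΦ1 : ∀ x, Measurable fun y : E => φ (Fin.cons y x) := fun x =>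
      hΦ.comp measurable_prodMk_right
    -- Integrating out one coordinate preserves the bounded influence of the others, so the
    -- one-variable bound can be iterated.
    set ψ : (Fin n → E) → ℝ := fun x => ∫ y, φ (Fin.cons y x) ∂μ
    have hψ : Measurable ψ :=
      (StronglyMeasurable.integral_prod_left' (μ := μ) hΦ.stronglyMeasurable).measurable
    have iΦ : ∀ x, Integrable (fun y => φ (Fin.cons y x)) μ := fun x =>
      integrable_of_abs_le (hΦ1 x) fun y => hK _
    have hψK : ∀ x, |ψ x| ≤ K := by
      intro x
      calc |ψ x| ≤ ∫ y, |φ (Fin.cons y x)| ∂μ := abs_integral_le_integral_abs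
        _ ≤ ∫ _, K ∂μ := integral_mono (iΦ x).abs (integrable_const _) fun y => hK _
        _ = K := by simp
    have hψd : ∀ x i z, |ψ x - ψ (Function.update x i z)| ≤ H (x i) + H z := by
      intro x i z
      simp only [ψ]
      rw [← integral_sub (iΦ _) (iΦ _)]
      calc _ ≤ ∫ y, |φ (Fin.cons y x) - φ (Fin.cons y (Function.update x i z))| ∂μ :=
            abs_integral_le_integral_abs
        _ ≤ ∫ _, (H (x i) + H z) ∂μ := by
            refine integral_mono ((iΦ _).sub (iΦ _)).abs (integrable_const _) fun y => ?_
            have := hd (Fin.cons y x) i.succ z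
            rwa [← Fin.cons_update, Fin.cons_succ] at this
        _ = _ := by simp
    have key := ih ψ hψ hψK hψd
    set κ := 4 * s ^ 2 * Real.exp (2 * s * b) * ∫ y, H y ^ 2 ∂μ
    rw [integral_pi_succ (hφ.const_mul s).exp fun x => abs_exp_mul_le hs (hK x),
      integral_pi_succ hφ hK]
    have hone : ∀ x, ∫ y, Real.exp (s * φ (Fin.cons y x)) ∂μ ≤
        Real.exp (s * ψ x) * Real.exp κ := by
      intro x
      refine integral_exp_mul_le (hΦ1 x) hH hs hH0 hHb (fun y => hK _) fun y z => ?_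
      have := hd (Fin.cons y x) 0 z
      rwa [Fin.update_cons_zero, Fin.cons_zero] at this
    have iψ : Integrable (fun x => Real.exp (s * ψ x)) (Measure.pi fun _ : Fin n => μ) :=
      integrable_of_abs_le (hψ.const_mul s).exp fun x => abs_exp_mul_le hs (hψK x)
    calc _ ≤ ∫ x, Real.exp (s * ψ x) * Real.exp κ ∂(Measure.pi fun _ : Fin n => μ) := by
          refine integral_mono_of_nonneg (ae_of_all _ fun x => integral_nonneg fun y =>
            (Real.exp_pos _).le) (iψ.mul_const _) (ae_of_all _ hone)
      _ = (∫ x, Real.exp (s * ψ x) ∂(Measure.pi fun _ : Fin n => μ)) * Real.exp κ :=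
          integral_mul_const _ _
      _ ≤ _ := mul_le_mul_of_nonneg_right key (Real.exp_pos _).le
      _ = _ := by
          rw [mul_assoc, ← Real.exp_add]
          congr 2
          push_cast
          ring

/-- A Bennett type deviation inequality for functions of independent variables, in the polynomial
form of Fuk and Nagaev. -/
theorem measure_sub_integral_ge_le {H : E → ℝ} (hH : Measurable H) {q y W K : ℝ} (hq : 0 < q)
    (hy : 0 < y) (hW : 0 < W) (hH0 : ∀ z, 0 ≤ H z) (hHb : ∀ z, H z ≤ 2 * y / (3 * q)) (n : ℕ)
    (hσ : n * ∫ z, H z ^ 2 ∂μ ≤ W)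
    {φ : (Fin n → E) → ℝ} (hφ : Measurable φ) (hK : ∀ x, |φ x| ≤ K)
    (hd : ∀ x i z, |φ x - φ (Function.update x i z)| ≤ H (x i) + H z) :
    (Measure.pi fun _ : Fin n => μ).real
      {x | ∫ x, φ x ∂(Measure.pi fun _ : Fin n => μ) + y ≤ φ x} ≤
      Real.exp (3 * q / 2) * (12 * q * W / y ^ 2) ^ (q / 2) := by
  set P := Measure.pi fun _ : Fin n => μ
  set b := 2 * y / (3 * q)
  have hb : 0 < b := by positivity
  set R := y * b / (8 * W)
  have hR : 0 < R := by positivity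
  have hRinv : 12 * q * W / y ^ 2 = R⁻¹ := by
    simp only [R, b]
    field_simp
    ring
  rw [hRinv]
  -- For `R ≤ 1` the right-hand side is at least one.
  rcases le_total R 1 with h1 | h1
  · refine measureReal_le_one.trans ?_
    have a1 : 1 ≤ Real.exp (3 * q / 2) := Real.one_le_exp (by positivity)
    have a2 : 1 ≤ R⁻¹ ^ (q / 2) := Real.one_le_rpow ((one_le_inv₀ hR).2 h1) (by positivity)
    nlinarith
  -- With this `s`, `exp (3 * s * b) = R`, and `y / (3 * b) = q / 2` gives `exp (-s * y) = R ^ (-q /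
  -- 2)`.
  · set s := Real.log R / (3 * b)
    have hs : 0 ≤ s := div_nonneg (Real.log_nonneg h1) (by positivity)
    have hsb : 3 * (s * b) = Real.log R := by
      simp only [s]
      field_simp
    have i1 : Integrable (fun x => Real.exp (s * φ x)) P :=
      integrable_of_abs_le (hφ.const_mul s).exp fun x => abs_exp_mul_le hs (hK x)
    have hch := measure_ge_le_exp_mul_mgf (μ := P) (X := φ) (∫ x, φ x ∂P + y) hs i1
    refine hch.trans ?_
    have hexp := integral_exp_mul_pi_le (μ := μ) hH hs hH0 hHb n φ hφ hK hd
    -- From `u ^ 2 ≤ 2 * exp u` at `u = s * b`, the exponent is at most `8 * R * W / b ^ 2`, which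
    -- the choice of `R` makes equal to `y / b = 3 * q / 2`.
    have hκ : n * (4 * s ^ 2 * Real.exp (2 * s * b) * ∫ z, H z ^ 2 ∂μ) ≤ 3 * q / 2 := by
      have q1 : (s * b) ^ 2 ≤ 2 * Real.exp (s * b) := by
        have := Real.quadratic_le_exp_of_nonneg (x := s * b) (by positivity)
        have : 0 ≤ s * b := by positivity
        linarith
      have q2 : (s * b) ^ 2 * Real.exp (2 * s * b) ≤ 2 * R := by
        calc (s * b) ^ 2 * Real.exp (2 * s * b)
            ≤ 2 * Real.exp (s * b) * Real.exp (2 * s * b) := by gcongr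
          _ = 2 * Real.exp (3 * (s * b)) := by
            rw [mul_assoc, ← Real.exp_add]
            ring_nf
          _ = 2 * R := by rw [hsb, Real.exp_log hR]
      have q3 : s ^ 2 * Real.exp (2 * s * b) ≤ 2 * R / b ^ 2 := by
        rw [le_div_iff₀ (by positivity)]
        calc _ = (s * b) ^ 2 * Real.exp (2 * s * b) := by ring
          _ ≤ _ := q2
      calc n * (4 * s ^ 2 * Real.exp (2 * s * b) * ∫ z, H z ^ 2 ∂μ)
          = 4 * (s ^ 2 * Real.exp (2 * s * b)) * (n * ∫ z, H z ^ 2 ∂μ) := by ring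
        _ ≤ 4 * (2 * R / b ^ 2) * W := by
          have : 0 ≤ ∫ z, H z ^ 2 ∂μ := integral_nonneg fun z => sq_nonneg _
          gcongr
        _ = 3 * q / 2 := by
          simp only [R, b]
          field_simp
          ring
    calc Real.exp (-s * (∫ x, φ x ∂P + y)) * mgf φ P s
        ≤ Real.exp (-s * (∫ x, φ x ∂P + y)) * (Real.exp (s * ∫ x, φ x ∂P) *
          Real.exp (3 * q / 2)) := by
          refine mul_le_mul_of_nonneg_left (hexp.trans ?_) (Real.exp_pos _).le
          exact mul_le_mul_of_nonneg_left (Real.exp_le_exp.2 hκ) (Real.exp_pos _).le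
      _ = Real.exp (3 * q / 2) * Real.exp (-(s * y)) := by
          rw [← mul_assoc, ← Real.exp_add, mul_comm]
          ring_nf
      _ = _ := by
          congr 1
          rw [Real.rpow_def_of_pos (inv_pos.2 hR), Real.log_inv, ← hsb]
          congr 1
          simp only [b]
          field_simp

end ExponentialMoment

section AbsDiff

theorem absDiff_le_add (a b : ℝ≥0∞) : absDiff a b ≤ a + b :=
  add_le_add tsub_le_self tsub_le_self

theorem absDiff_triangle (a b c : ℝ≥0∞) : absDiff a c ≤ absDiff a b + absDiff b c := by
  unfold absDiff
  have h1 : a - c ≤ (a - b) + (b - c) := tsub_le_tsub_add_tsub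
  have h2 : c - a ≤ (c - b) + (b - a) := tsub_le_tsub_add_tsub
  calc _ ≤ _ := add_le_add h1 h2
    _ = _ := by ring

theorem absDiff_eq_enorm_sub {a b : ℝ} (ha : 0 ≤ a) (hb : 0 ≤ b) :
    absDiff (ENNReal.ofReal a) (ENNReal.ofReal b) = ‖b - a‖ₑ := by
  rw [absDiff, ← ENNReal.ofReal_sub _ hb, ← ENNReal.ofReal_sub _ ha, Real.enorm_eq_ofReal_abs]
  rcases le_total a b with h | h
  · rw [ENNReal.ofReal_of_nonpos (sub_nonpos.2 h), zero_add, abs_of_nonneg (sub_nonneg.2 h)]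
  · rw [ENNReal.ofReal_of_nonpos (sub_nonpos.2 h), add_zero, abs_of_nonpos (sub_nonpos.2 h),
      neg_sub]

end AbsDiff

/-! ### Moments and tails of weighted deviations of the empirical measure. -/

section Deviation

variable {E J : Type*} [MeasurableSpace E]

/-- The weighted deviation `∑ c_j |μ(F_j) - L_n(F_j)|` of the empirical measure. -/
noncomputable def deviation (c : J → ℝ≥0∞) (F : J → Set E) (μ : Measure E) {n : ℕ}
    (x : Fin n → E) : ℝ≥0∞ :=
  ∑' j, c j * absDiff (μ (F j)) (empiricalMeasure x (F j))

theorem empiricalMeasure_apply {n : ℕ} (x : Fin n → E) {A : Set E} (hA : MeasurableSet A) :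
    empiricalMeasure x A = (n : ℝ≥0∞)⁻¹ * ∑ i, A.indicator 1 (x i) := by
  simp only [empiricalMeasure, Measure.smul_apply, Measure.finsetSum_apply, smul_eq_mul,
    Measure.dirac_apply' _ hA]

theorem measurable_empiricalMeasure_apply {n : ℕ} {A : Set E} (hA : MeasurableSet A) :
    Measurable fun x : Fin n → E => empiricalMeasure x A := by
  simp_rw [empiricalMeasure_apply _ hA]
  refine Measurable.const_mul (Finset.measurable_sum _ fun i _ => ?_) _
  exact (measurable_one.indicator hA).comp (measurable_pi_apply i)

theorem measurable_absDiff_empiricalMeasure (μ : Measure E) {n : ℕ} {A : Set E}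
    (hA : MeasurableSet A) :
    Measurable fun x : Fin n → E => absDiff (μ A) (empiricalMeasure x A) := by
  have h := measurable_empiricalMeasure_apply (n := n) hA
  exact (measurable_const.sub h).add (h.sub measurable_const)

/-- Changing one sample point moves mass `1 / n` from the sets containing the old point to those
containing the new one. -/
theorem deviation_le_add_update (μ : Measure E) (c : J → ℝ≥0∞) {F : J → Set E}
    (hF : ∀ j, MeasurableSet (F j)) {n : ℕ} (x : Fin n → E) (i : Fin n) (z : E) :
    deviation c F μ x ≤ deviation c F μ (Function.update x i z) +
      (n : ℝ≥0∞)⁻¹ * (∑' j, c j * (F j).indicator 1 (x i) + ∑' j, c j * (F j).indicator 1 z) := by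
  have hcell : ∀ (A : Set E), MeasurableSet A → ∀ (x : Fin n → E) (z : E), empiricalMeasure x A ≤
      empiricalMeasure (Function.update x i z) A + (n : ℝ≥0∞)⁻¹ * A.indicator 1 (x i) := by
    intro A hA x z
    rw [empiricalMeasure_apply x hA, empiricalMeasure_apply _ hA, ← mul_add]
    gcongr
    rw [← Finset.add_sum_erase _ _ (Finset.mem_univ i), add_comm]
    gcongr
    calc ∑ k ∈ Finset.univ.erase i, A.indicator 1 (x k)
        = ∑ k ∈ Finset.univ.erase i, A.indicator (1 : E → ℝ≥0∞) (Function.update x i z k) := by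
          refine Finset.sum_congr rfl fun k hk => ?_
          rw [Function.update_of_ne (Finset.ne_of_mem_erase hk)]
      _ ≤ _ := Finset.sum_le_sum_of_subset (Finset.erase_subset _ _)
  have hdiff : ∀ j, absDiff (empiricalMeasure (Function.update x i z) (F j))
      (empiricalMeasure x (F j)) ≤
      (n : ℝ≥0∞)⁻¹ * ((F j).indicator 1 (x i) + (F j).indicator 1 z) := by
    intro j
    have h1 := hcell (F j) (hF j) x z
    have h2 := hcell (F j) (hF j) (Function.update x i z) (x i)
    rw [Function.update_idem, Function.update_eq_self, Function.update_self] at h2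
    rw [absDiff, mul_add, add_comm]
    exact add_le_add (tsub_le_iff_left.2 h1) (tsub_le_iff_left.2 h2)
  unfold deviation
  rw [← ENNReal.tsum_add, ← ENNReal.tsum_mul_left, ← ENNReal.tsum_add]
  refine ENNReal.tsum_le_tsum fun j => ?_
  calc _ ≤ c j * (absDiff (μ (F j)) (empiricalMeasure (Function.update x i z) (F j)) +
        (n : ℝ≥0∞)⁻¹ * ((F j).indicator 1 (x i) + (F j).indicator 1 z)) := by
        gcongr
        exact (absDiff_triangle _ _ _).trans (add_le_add le_rfl (hdiff j))
    _ = _ := by ring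

variable [Countable J]

theorem measurable_deviation (c : J → ℝ≥0∞) {F : J → Set E} (hF : ∀ j, MeasurableSet (F j))
    (μ : Measure E) {n : ℕ} : Measurable fun x : Fin n → E => deviation c F μ x :=
  Measurable.tsum fun j => (measurable_absDiff_empiricalMeasure μ (hF j)).const_mul _

variable (μ : Measure E) [IsProbabilityMeasure μ]

theorem lintegral_empiricalMeasure {n : ℕ} (hn : 1 ≤ n) {A : Set E} (hA : MeasurableSet A) :
    ∫⁻ x, empiricalMeasure x A ∂(Measure.pi fun _ : Fin n => μ) = μ A := by
  simp_rw [empiricalMeasure_apply _ hA]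
  have hm : ∀ i : Fin n, Measurable fun x : Fin n → E => A.indicator (1 : E → ℝ≥0∞) (x i) :=
    fun i => (measurable_one.indicator hA).comp (measurable_pi_apply i)
  rw [lintegral_const_mul _ (Finset.measurable_sum _ fun i _ => hm i),
    lintegral_finsetSum _ fun i _ => hm i]
  have : ∀ i : Fin n, ∫⁻ x, A.indicator (1 : E → ℝ≥0∞) (x i) ∂(Measure.pi fun _ : Fin n => μ) =
      μ A := by
    intro i
    rw [(measurePreserving_eval (fun _ : Fin n => μ) i).lintegral_comp
      (measurable_one.indicator hA), lintegral_indicator_one hA]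
  simp only [this, Finset.sum_const, Finset.card_univ, Fintype.card_fin, nsmul_eq_mul]
  rw [← mul_assoc, ENNReal.inv_mul_cancel (by simp; omega) (by simp), one_mul]

/-- This bound has no gain in `n` but involves masses rather than their square roots. It serves for
the outer shells and for the mean when `x` is large. -/
theorem lintegral_deviation_le_two_mul (c : J → ℝ≥0∞) {F : J → Set E}
    (hF : ∀ j, MeasurableSet (F j)) {n : ℕ} (hn : 1 ≤ n) :
    ∫⁻ x, deviation c F μ x ∂(Measure.pi fun _ : Fin n => μ) ≤ 2 * ∑' j, c j * μ (F j) := by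
  unfold deviation
  rw [lintegral_tsum fun j =>
    ((measurable_absDiff_empiricalMeasure μ (hF j)).const_mul _).aemeasurable,
    ← ENNReal.tsum_mul_left]
  refine ENNReal.tsum_le_tsum fun j => ?_
  rw [lintegral_const_mul _ (measurable_absDiff_empiricalMeasure μ (hF j))]
  calc _ ≤ c j * ∫⁻ x, (μ (F j) + empiricalMeasure x (F j))
        ∂(Measure.pi fun _ : Fin n => μ) := by
        gcongr
        exact absDiff_le_add _ _
    _ = 2 * (c j * μ (F j)) := by
        rw [lintegral_add_left measurable_const, lintegral_empiricalMeasure μ hn (hF j)]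
        simp only [lintegral_const, measure_univ, mul_one]
        ring

/-- The empirical mass is an average of `n` independent indicators; their variance is at most their
mean `μ A`. -/
theorem lintegral_absDiff_sq_le {n : ℕ} (hn : 1 ≤ n) {A : Set E} (hA : MeasurableSet A) :
    ∫⁻ x, absDiff (μ A) (empiricalMeasure x A) ^ 2 ∂(Measure.pi fun _ : Fin n => μ) ≤
      μ A * (n : ℝ≥0∞)⁻¹ := by
  set P := Measure.pi fun _ : Fin n => μ
  have hn0 : (n : ℝ) ≠ 0 := by positivity
  let f : E → ℝ := A.indicator 1
  have hf : Measurable f := measurable_one.indicator hA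
  have hfb : ∀ y, |f y| ≤ 1 := by
    intro y
    simp only [f, indicator]
    split_ifs <;> simp
  have hf0 : ∀ y, 0 ≤ f y := fun y => indicator_nonneg (fun _ _ => zero_le_one) y
  have hfL : MemLp f 2 μ := MemLp.of_bound hf.aestronglyMeasurable 1 (ae_of_all _ hfb)
  have hfi : ∫ y, f y ∂μ = μ.real A := by
    rw [integral_indicator_one hA]
  let Y : (Fin n → E) → ℝ := fun x => (n : ℝ)⁻¹ * ∑ i, f (x i)
  have hsumeq : (∑ i, fun x : Fin n → E => f (x i)) = fun x => ∑ i, f (x i) := by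
    ext x
    simp
  have hvar : Var[Y; P] = (n : ℝ)⁻¹ * Var[f; μ] := by
    have h1 := variance_sum_pi (μ := fun _ : Fin n => μ) (X := fun _ => f) fun _ => hfL
    rw [hsumeq] at h1
    simp only [Y]
    rw [variance_const_mul, h1]
    simp only [Finset.sum_const, Finset.card_univ, Fintype.card_fin, nsmul_eq_mul]
    field_simp
  have hvf : Var[f; μ] ≤ μ.real A := by
    refine (variance_le_expectation_sq hf.aestronglyMeasurable).trans (le_of_eq ?_)
    rw [← hfi]
    refine integral_congr_ae (ae_of_all _ fun y => ?_)
    simp only [f, indicator, Pi.pow_apply]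
    split_ifs <;> simp
  have hif : ∀ i : Fin n, Integrable (fun x : Fin n → E => f (x i)) P := fun i =>
    integrable_of_abs_le (hf.comp (measurable_pi_apply i)) fun x => hfb _
  have hEY : ∫ x, Y x ∂P = μ.real A := by
    simp only [Y]
    rw [integral_const_mul, integral_finsetSum _ fun i _ => hif i]
    have : ∀ i : Fin n, ∫ x, f (x i) ∂P = μ.real A := by
      intro i
      rw [← hfi]
      exact integral_comp_eval (μ := fun _ : Fin n => μ) (i := i) hf.aestronglyMeasurable
    simp only [this, Finset.sum_const, Finset.card_univ, Fintype.card_fin, nsmul_eq_mul]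
    field_simp
  have hYL : MemLp Y 2 P := by
    refine MemLp.of_bound (C := (n : ℝ)⁻¹ * n) ?_ ?_
    · exact ((Finset.measurable_sum _ fun i _ =>
        hf.comp (measurable_pi_apply i)).const_mul _).aestronglyMeasurable
    · refine ae_of_all _ fun x => ?_
      rw [Real.norm_eq_abs, abs_mul, abs_of_nonneg (by positivity : 0 ≤ (n : ℝ)⁻¹)]
      gcongr
      calc |∑ i, f (x i)| ≤ ∑ i : Fin n, |f (x i)| := Finset.abs_sum_le_sum_abs _ _
        _ ≤ ∑ _i : Fin n, 1 := Finset.sum_le_sum fun i _ => hfb _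
        _ = n := by simp
  have hYe : ∀ x : Fin n → E, empiricalMeasure x A = ENNReal.ofReal (Y x) := by
    intro x
    rw [empiricalMeasure_apply x hA, ENNReal.ofReal_mul (by positivity),
      ENNReal.ofReal_inv_of_pos (by positivity), ENNReal.ofReal_natCast,
      ENNReal.ofReal_sum_of_nonneg fun i _ => hf0 _]
    congr 2
    ext i
    simp only [f, indicator]
    split_ifs <;> simp
  have hY0 : ∀ x, 0 ≤ Y x := fun x =>
    mul_nonneg (by positivity) (Finset.sum_nonneg fun i _ => hf0 _)
  calc ∫⁻ x, absDiff (μ A) (empiricalMeasure x A) ^ 2 ∂P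
      = ∫⁻ x, ‖Y x - P[Y]‖ₑ ^ 2 ∂P := by
        refine lintegral_congr fun x => ?_
        rw [hYe, hEY, ← ofReal_measureReal (measure_ne_top μ A),
          absDiff_eq_enorm_sub measureReal_nonneg (hY0 x)]
    _ = ENNReal.ofReal (Var[Y; P]) := hYL.ofReal_variance_eq.symm
    _ ≤ ENNReal.ofReal (μ.real A * (n : ℝ)⁻¹) := by
        refine ENNReal.ofReal_le_ofReal ?_
        rw [hvar, mul_comm]
        gcongr
    _ = _ := by
        rw [ENNReal.ofReal_mul measureReal_nonneg, ofReal_measureReal (measure_ne_top μ A),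
          ENNReal.ofReal_inv_of_pos (by positivity), ENNReal.ofReal_natCast]

/-- Minkowski's inequality for a countable sum: expand the square and apply Cauchy-Schwarz to each
product. No independence between cells is needed. -/
theorem lintegral_tsum_sq_le {X : Type*} [MeasurableSpace X] {P : Measure X} (c s : J → ℝ≥0∞)
    {Y : J → X → ℝ≥0∞} (hY : ∀ j, Measurable (Y j))
    (hs : ∀ j, (∫⁻ x, Y j x ^ (2 : ℝ) ∂P) ^ (1 / 2 : ℝ) ≤ s j) :
    ∫⁻ x, (∑' j, c j * Y j x) ^ 2 ∂P ≤ (∑' j, c j * s j) ^ 2 := by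
  have e : ∀ a : J → ℝ≥0∞, (∑' j, a j) ^ 2 = ∑' j, ∑' k, a j * a k := by
    intro a
    rw [sq, ← ENNReal.tsum_mul_right]
    simp_rw [ENNReal.tsum_mul_left]
  simp_rw [e]
  have hm : ∀ j k, Measurable fun x => c j * Y j x * (c k * Y k x) := fun j k =>
    ((hY j).const_mul _).mul ((hY k).const_mul _)
  rw [lintegral_tsum fun j => (Measurable.tsum fun k => hm j k).aemeasurable]
  refine ENNReal.tsum_le_tsum fun j => ?_
  rw [lintegral_tsum fun k => (hm j k).aemeasurable]
  refine ENNReal.tsum_le_tsum fun k => ?_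
  have h1 : ∀ x, c j * Y j x * (c k * Y k x) = c j * c k * (Y j * Y k) x := by
    intro x
    rw [Pi.mul_apply]
    ring
  simp_rw [h1]
  rw [lintegral_const_mul _ ((hY j).mul (hY k))]
  calc _ ≤ c j * c k * ((∫⁻ x, Y j x ^ (2 : ℝ) ∂P) ^ (1 / 2 : ℝ) *
        (∫⁻ x, Y k x ^ (2 : ℝ) ∂P) ^ (1 / 2 : ℝ)) := by
        gcongr
        exact ENNReal.lintegral_mul_le_Lp_mul_Lq P Real.HolderConjugate.two_two
          (hY j).aemeasurable (hY k).aemeasurable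
    _ ≤ c j * c k * (s j * s k) := by
        gcongr
        · exact hs j
        · exact hs k
    _ = _ := by ring

theorem lintegral_deviation_sq_le (c : J → ℝ≥0∞) {F : J → Set E}
    (hF : ∀ j, MeasurableSet (F j)) {n : ℕ} (hn : 1 ≤ n) :
    ∫⁻ x, deviation c F μ x ^ 2 ∂(Measure.pi fun _ : Fin n => μ) ≤
      (∑' j, c j * μ (F j) ^ (1 / 2 : ℝ)) ^ 2 * (n : ℝ≥0∞)⁻¹ := by
  have h := lintegral_tsum_sq_le (P := Measure.pi fun _ : Fin n => μ) c
    (fun j => μ (F j) ^ (1 / 2 : ℝ) * ((n : ℝ≥0∞)⁻¹) ^ (1 / 2 : ℝ))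
    (fun j => measurable_absDiff_empiricalMeasure μ (hF j)) fun j => by
      rw [← ENNReal.mul_rpow_of_nonneg _ _ (by norm_num)]
      refine ENNReal.rpow_le_rpow ?_ (by norm_num)
      simp_rw [ENNReal.rpow_two]
      exact lintegral_absDiff_sq_le μ hn (hF j)
  refine h.trans (le_of_eq ?_)
  simp_rw [← mul_assoc]
  rw [ENNReal.tsum_mul_right, mul_pow, ← ENNReal.rpow_two (_ ^ (1 / 2 : ℝ)), ← ENNReal.rpow_mul]
  norm_num

theorem lintegral_deviation_le (c : J → ℝ≥0∞) {F : J → Set E}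
    (hF : ∀ j, MeasurableSet (F j)) {n : ℕ} (hn : 1 ≤ n) :
    ∫⁻ x, deviation c F μ x ∂(Measure.pi fun _ : Fin n => μ) ≤
      (∑' j, c j * μ (F j) ^ (1 / 2 : ℝ)) * ((n : ℝ≥0∞)⁻¹) ^ (1 / 2 : ℝ) := by
  have h1 := ENNReal.lintegral_mul_le_Lp_mul_Lq (Measure.pi fun _ : Fin n => μ)
    Real.HolderConjugate.two_two (measurable_deviation c hF μ).aemeasurable
    (aemeasurable_const (b := (1 : ℝ≥0∞)))
  simp only [Pi.mul_apply, mul_one, one_pow, ENNReal.one_rpow, lintegral_const, measure_univ,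
    ENNReal.rpow_two] at h1
  refine h1.trans ((ENNReal.rpow_le_rpow (lintegral_deviation_sq_le μ c hF hn)
    (by norm_num)).trans (le_of_eq ?_))
  rw [ENNReal.mul_rpow_of_nonneg _ _ (by norm_num), ← ENNReal.rpow_two, ← ENNReal.rpow_mul]
  norm_num

/-- Fuk-Nagaev type inequality for the deviation of the empirical measure around its mean. -/
theorem measure_deviation_ge_le (c : J → ℝ≥0∞) {F : J → Set E} (hF : ∀ j, MeasurableSet (F j))
    {n : ℕ} (hn : 1 ≤ n) {h : E → ℝ} (hh : Measurable h) (hh0 : ∀ y, 0 ≤ h y)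
    (hcF : ∀ y, ∑' j, c j * (F j).indicator 1 y ≤ ENNReal.ofReal (h y)) {q y W : ℝ} (hq : 0 < q)
    (hy : 0 < y) (hW : 0 < W) (hhb : ∀ z, h z ≤ n * (2 * y / (3 * q)))
    (hσ : ∫ z, h z ^ 2 ∂μ ≤ n * W)
    (hmean : ∫⁻ x, deviation c F μ x ∂(Measure.pi fun _ : Fin n => μ) ≤ ENNReal.ofReal y) :
    (Measure.pi fun _ : Fin n => μ).real {x | ENNReal.ofReal (2 * y) ≤ deviation c F μ x} ≤
      Real.exp (3 * q / 2) * (12 * q * W / y ^ 2) ^ (q / 2) := by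
  set P := Measure.pi fun _ : Fin n => μ
  have hn0 : (0 : ℝ) < n := by exact_mod_cast hn
  set b := 2 * y / (3 * q)
  have hb : 0 < b := by positivity
  have hsum : ∑' j, c j * μ (F j) ≤ ENNReal.ofReal (n * b) := by
    calc ∑' j, c j * μ (F j) = ∫⁻ z, ∑' j, c j * (F j).indicator 1 z ∂μ := by
          rw [lintegral_tsum fun j =>
            ((measurable_one.indicator (hF j)).const_mul _).aemeasurable]
          refine tsum_congr fun j => ?_
          rw [lintegral_const_mul _ (measurable_one.indicator (hF j)),
            lintegral_indicator_one (hF j)]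
      _ ≤ ∫⁻ _, ENNReal.ofReal (n * b) ∂μ :=
          lintegral_mono fun z => (hcF z).trans (ENNReal.ofReal_le_ofReal (hhb z))
      _ = _ := by simp
  have hbdd : ∀ x : Fin n → E, deviation c F μ x ≤ ENNReal.ofReal (2 * (n * b)) := by
    intro x
    calc deviation c F μ x ≤ ∑' j, (c j * μ (F j) + c j * empiricalMeasure x (F j)) := by
          refine ENNReal.tsum_le_tsum fun j => ?_
          rw [← mul_add]
          gcongr
          exact absDiff_le_add _ _
      _ = ∑' j, c j * μ (F j) +
          (n : ℝ≥0∞)⁻¹ * ∑ i, ∑' j, c j * (F j).indicator 1 (x i) := by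
          rw [ENNReal.tsum_add, ← Summable.tsum_finsetSum fun i _ => ENNReal.summable,
            ← ENNReal.tsum_mul_left]
          congr 2
          ext j
          rw [empiricalMeasure_apply x (hF j), ← Finset.mul_sum]
          ring
      _ ≤ ENNReal.ofReal (n * b) + (n : ℝ≥0∞)⁻¹ * ∑ _i : Fin n, ENNReal.ofReal (n * b) := by
          gcongr with i
          exact (hcF _).trans (ENNReal.ofReal_le_ofReal (hhb _))
      _ = _ := by
          simp only [Finset.sum_const, Finset.card_univ, Fintype.card_fin, nsmul_eq_mul]
          rw [← mul_assoc, ENNReal.inv_mul_cancel (by simp; omega) (by simp), one_mul,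
            ← ENNReal.ofReal_add (by positivity) (by positivity)]
          ring_nf
  have hfin : ∀ x : Fin n → E, deviation c F μ x ≠ ∞ := fun x =>
    ne_top_of_le_ne_top ENNReal.ofReal_ne_top (hbdd x)
  set φ : (Fin n → E) → ℝ := fun x => (deviation c F μ x).toReal
  have hφm : Measurable φ := (measurable_deviation c hF μ).ennreal_toReal
  have hφK : ∀ x, |φ x| ≤ 2 * (n * b) := by
    intro x
    rw [abs_of_nonneg ENNReal.toReal_nonneg]
    exact ENNReal.toReal_le_of_le_ofReal (by positivity) (hbdd x)
  have hone : ∀ x i z, φ x - φ (Function.update x i z) ≤ h (x i) / n + h z / n := by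
    intro x i z
    have h1 : deviation c F μ x ≤ deviation c F μ (Function.update x i z) +
        ENNReal.ofReal (h (x i) / n + h z / n) := by
      refine (deviation_le_add_update μ c hF x i z).trans (add_le_add le_rfl ?_)
      rw [← add_div, div_eq_inv_mul, ENNReal.ofReal_mul (by positivity),
        ENNReal.ofReal_inv_of_pos hn0, ENNReal.ofReal_natCast, ENNReal.ofReal_add (hh0 _) (hh0 _)]
      gcongr
      · exact hcF _
      · exact hcF _
    have h2 := ENNReal.toReal_mono (ENNReal.add_ne_top.2 ⟨hfin _, ENNReal.ofReal_ne_top⟩) h1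
    rw [ENNReal.toReal_add (hfin _) ENNReal.ofReal_ne_top, ENNReal.toReal_ofReal
      (add_nonneg (div_nonneg (hh0 _) hn0.le) (div_nonneg (hh0 _) hn0.le))] at h2
    simp only [φ]
    linarith
  have hd : ∀ x i z, |φ x - φ (Function.update x i z)| ≤ h (x i) / n + h z / n := by
    intro x i z
    rw [abs_le]
    refine ⟨?_, hone x i z⟩
    have := hone (Function.update x i z) i (x i)
    rw [Function.update_idem, Function.update_eq_self, Function.update_self] at this
    linarith
  have hφint : ∫ x, φ x ∂P ≤ y := by
    rw [integral_toReal (measurable_deviation c hF μ).aemeasurable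
      (ae_of_all _ fun x => (hfin x).lt_top)]
    exact ENNReal.toReal_le_of_le_ofReal hy.le hmean
  -- One sample point has influence `h / n`, so the variance proxy is `n * ∫ (h / n) ^ 2`, at most
  -- `W` by `hσ`.
  have key := measure_sub_integral_ge_le (μ := μ) (H := fun z => h z / n) (q := q) (y := y) (W := W)
    (hh.div_const _) hq hy hW (fun z => div_nonneg (hh0 z) hn0.le)
    (fun z => by rw [div_le_iff₀ hn0, mul_comm]; exact hhb z) n (by
      simp_rw [div_pow]
      rw [integral_div, mul_div_assoc', div_le_iff₀ (by positivity)]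
      nlinarith) hφm hφK hd
  -- The mean is at most `y`, so exceeding `2 * y` means exceeding the mean by `y`.
  refine (measureReal_mono ?_).trans key
  intro x hx
  have h3 : 2 * y ≤ φ x := (ENNReal.ofReal_le_iff_le_toReal (hfin x)).1 hx
  change _ ≤ φ x
  linarith

end Deviation

/-! ### Geometric sums over powers of two. -/

section DyadicSums

theorem tsum_option_eq {f : Option ℤ → ℝ≥0∞} (h : f none = 0) :
    ∑' k, f k = ∑' k : ℤ, f (some k) := by
  refine ((Option.some_injective ℤ).tsum_eq ?_).symm
  intro k hk
  rcases k with _ | k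
  · exact absurd h hk
  · exact mem_range_self k

/-- Downwards from the largest power below `T` the terms decay geometrically with ratio `2 ^ (-c)`.
-/
theorem tsum_zpow_rpow_le_of_pos {c T : ℝ} (hc : 0 < c) (hT : 0 < T) :
    ∑' k : ℤ, (if (2 : ℝ) ^ k ≤ T then ENNReal.ofReal (((2 : ℝ) ^ k) ^ c) else 0) ≤
      ENNReal.ofReal ((1 - 2 ^ (-c))⁻¹ * T ^ c) := by
  set K := Int.log 2 T
  have h1 : (2 : ℝ) ^ K ≤ T := by exact_mod_cast Int.zpow_log_le_self (b := 2) one_lt_two hT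
  have h2 : T < (2 : ℝ) ^ (K + 1) := by exact_mod_cast Int.lt_zpow_succ_log_self one_lt_two T
  have hinj : Function.Injective fun j : ℕ => K - (j : ℤ) := fun a b h => by
    simpa using h
  have hr0 : (0 : ℝ) ≤ 2 ^ (-c) := by positivity
  have hr1 : (2 : ℝ) ^ (-c) < 1 := Real.rpow_lt_one_of_one_lt_of_neg one_lt_two (by linarith)
  rw [← hinj.tsum_eq]
  · have hterm : ∀ j : ℕ, (if (2 : ℝ) ^ (K - (j : ℤ)) ≤ T then
        ENNReal.ofReal (((2 : ℝ) ^ (K - (j : ℤ))) ^ c) else 0) ≤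
        ENNReal.ofReal (T ^ c * (2 ^ (-c)) ^ j) := by
      intro j
      split_ifs
      · refine ENNReal.ofReal_le_ofReal ?_
        rw [zpow_sub₀ two_ne_zero, Real.div_rpow (by positivity) (by positivity), zpow_natCast,
          ← Real.rpow_natCast, ← Real.rpow_natCast, ← Real.rpow_mul (by norm_num),
          ← Real.rpow_mul (by norm_num), mul_comm (j : ℝ) c, neg_mul, Real.rpow_neg (by norm_num),
          ← div_eq_mul_inv]
        gcongr
      · exact zero_le
    refine (ENNReal.tsum_le_tsum hterm).trans (le_of_eq ?_)
    rw [← ENNReal.ofReal_tsum_of_nonneg (fun j => by positivity)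
      ((summable_geometric_of_lt_one hr0 hr1).mul_left _), tsum_mul_left,
      tsum_geometric_of_lt_one hr0 hr1, mul_comm]
  · intro k hk
    have hk2 : (2 : ℝ) ^ k ≤ T := by
      by_contra h
      exact hk (if_neg h)
    have := (zpow_lt_zpow_iff_right₀ (one_lt_two (α := ℝ))).1 (hk2.trans_lt h2)
    exact ⟨(K - k).toNat, by simp only; omega⟩

/-- Upwards from the first power above `T` the terms decay geometrically with ratio `2 ^ c`. -/
theorem tsum_zpow_rpow_le_of_neg {c T : ℝ} (hc : c < 0) (hT : 0 < T) :
    ∑' k : ℤ, (if (2 : ℝ) ^ k ≤ T then 0 else ENNReal.ofReal (((2 : ℝ) ^ k) ^ c)) ≤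
      ENNReal.ofReal ((1 - 2 ^ c)⁻¹ * T ^ c) := by
  set K := Int.log 2 T + 1
  have h1 : (2 : ℝ) ^ (K - 1) ≤ T := by
    simp only [K, add_sub_cancel_right]
    exact_mod_cast Int.zpow_log_le_self (b := 2) one_lt_two hT
  have h2 : T < (2 : ℝ) ^ K := by exact_mod_cast Int.lt_zpow_succ_log_self one_lt_two T
  have hinj : Function.Injective fun j : ℕ => K + (j : ℤ) := fun a b h => by
    simpa using h
  have hr0 : (0 : ℝ) ≤ 2 ^ c := by positivity
  have hr1 : (2 : ℝ) ^ c < 1 := Real.rpow_lt_one_of_one_lt_of_neg one_lt_two hc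
  rw [← hinj.tsum_eq]
  · have hterm : ∀ j : ℕ, (if (2 : ℝ) ^ (K + (j : ℤ)) ≤ T then 0 else
        ENNReal.ofReal (((2 : ℝ) ^ (K + (j : ℤ))) ^ c)) ≤
        ENNReal.ofReal (T ^ c * (2 ^ c) ^ j) := by
      intro j
      split_ifs
      · exact zero_le
      · refine ENNReal.ofReal_le_ofReal ?_
        rw [zpow_add₀ two_ne_zero, Real.mul_rpow (by positivity) (by positivity), zpow_natCast,
          ← Real.rpow_natCast, ← Real.rpow_natCast, ← Real.rpow_mul (by norm_num),
          ← Real.rpow_mul (by norm_num), mul_comm (j : ℝ) c]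
        gcongr ?_ * _
        exact Real.rpow_le_rpow_of_nonpos hT h2.le hc.le
    refine (ENNReal.tsum_le_tsum hterm).trans (le_of_eq ?_)
    rw [← ENNReal.ofReal_tsum_of_nonneg (fun j => by positivity)
      ((summable_geometric_of_lt_one hr0 hr1).mul_left _), tsum_mul_left,
      tsum_geometric_of_lt_one hr0 hr1, mul_comm]
  · intro k hk
    have hk2 : T < (2 : ℝ) ^ k := by
      by_contra h
      exact hk (if_pos (not_lt.1 h))
    have := (zpow_lt_zpow_iff_right₀ (one_lt_two (α := ℝ))).1 (h1.trans_lt hk2)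
    exact ⟨(k - K).toNat, by simp only; omega⟩

theorem tsum_lintegral_Ioc_zpow_le (f : ℝ → ℝ≥0∞) :
    ∑' k : ℤ, ∫⁻ t in Ioc ((2 : ℝ) ^ (k - 1)) (2 ^ k), f t ≤ ∫⁻ t in Ioi (0 : ℝ), f t := by
  have hdisj : Pairwise (Function.onFun Disjoint fun k : ℤ => Ioc ((2 : ℝ) ^ (k - 1)) (2 ^ k)) := by
    intro i j hij
    refine Set.disjoint_left.2 fun t h1 h2 => hij ?_
    have a := (zpow_lt_zpow_iff_right₀ (one_lt_two (α := ℝ))).1 (h1.1.trans_le h2.2)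
    have b := (zpow_lt_zpow_iff_right₀ (one_lt_two (α := ℝ))).1 (h2.1.trans_le h1.2)
    omega
  rw [← lintegral_iUnion (fun _ => measurableSet_Ioc) hdisj]
  refine lintegral_mono_set (iUnion_subset fun k t ht => ?_)
  exact lt_trans (zpow_pos two_pos _) ht.1

end DyadicSums

/-! ### Masses of shells, tail integral and moments. -/

section ShellMass

variable {E : Type*} [MetricSpace E] [MeasurableSpace E]

/-- The mass of the dyadic shell `k` around `x₀`. -/
noncomputable def shellMass (μ : Measure E) (x₀ : E) (k : Option ℤ) : ℝ≥0∞ :=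
  μ (shell x₀ ⁻¹' {k})

theorem lintegral_shell [BorelSpace E] (μ : Measure E) (x₀ : E) (a : Option ℤ → ℝ≥0∞) :
    ∫⁻ y, a (shell x₀ y) ∂μ = ∑' k, a k * shellMass μ x₀ k :=
  lintegral_fiber (measurable_shell x₀) μ a

theorem shellMass_le_tail (μ : Measure E) (x₀ : E) (k : ℤ) :
    shellMass μ x₀ (some k) ≤ tail μ x₀ (2 ^ (k - 1)) := by
  refine measure_mono fun y hy => ?_
  rw [mem_compl_iff, mem_closedBall, not_le, dist_comm]
  exact (shell_eq_some_iff.1 hy).1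

theorem tail_anti (μ : Measure E) (x₀ : E) {s t : ℝ} (h : s ≤ t) : tail μ x₀ t ≤ tail μ x₀ s :=
  measure_mono (compl_subset_compl.2 (closedBall_subset_closedBall h))

theorem tail_le_of_weakMoment (μ : Measure E) (x₀ : E) {q t : ℝ} (ht : 0 < t) :
    tail μ x₀ t ≤ weakMoment q μ x₀ * ENNReal.ofReal (t ^ (-q)) := by
  have h : ENNReal.ofReal (t ^ q) * tail μ x₀ t ≤ weakMoment q μ x₀ :=
    le_iSup₂ (f := fun (t : ℝ) (_ : 0 ≤ t) => ENNReal.ofReal (t ^ q) * tail μ x₀ t) t ht.le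
  calc tail μ x₀ t = ENNReal.ofReal (t ^ q) * tail μ x₀ t * ENNReal.ofReal (t ^ (-q)) := by
        rw [mul_right_comm, ← ENNReal.ofReal_mul (by positivity), ← Real.rpow_add ht,
          add_neg_cancel, Real.rpow_zero, ENNReal.ofReal_one, one_mul]
    _ ≤ _ := by gcongr

theorem shellRadius_some_rpow {p : ℝ} (hp : 0 ≤ p) (k : ℤ) :
    (shellRadius (some k) : ℝ≥0∞) ^ p = ENNReal.ofReal (((2 : ℝ) ^ k) ^ p) := by
  rw [← ENNReal.ofReal_rpow_of_nonneg (by positivity) hp, shellRadius, ← ENNReal.ofReal_coe_nnreal]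
  congr 2

theorem shellRadius_none_rpow {p : ℝ} (hp : 0 < p) : (shellRadius none : ℝ≥0∞) ^ p = 0 := by
  simp [shellRadius, hp]

/-- The mass of shell `k` is at most the tail at `2 ^ (k - 1)`, hence at most the tail throughout
the interval from `2 ^ (k - 2)` to `2 ^ (k - 1)`. Integrating there yields `2 ^ ((k - 2) * p)`, a
factor `4 ^ p` short of the weight. -/
theorem tsum_shellRadius_mul_sqrt_le (μ : Measure E) (x₀ : E) {p : ℝ} (hp : 1 ≤ p) :
    ∑' k, (shellRadius k : ℝ≥0∞) ^ p * shellMass μ x₀ k ^ (1 / 2 : ℝ) ≤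
      4 ^ p * tailIntegral p μ x₀ := by
  have hp0 : 0 < p := by linarith
  rw [tsum_option_eq (by rw [shellRadius_none_rpow hp0, zero_mul])]
  set f : ℝ → ℝ≥0∞ := fun t => tail μ x₀ t ^ (1 / 2 : ℝ) * ENNReal.ofReal (t ^ (p - 1))
  have hterm : ∀ k : ℤ, (shellRadius (some k) : ℝ≥0∞) ^ p * shellMass μ x₀ (some k) ^ (1 / 2 : ℝ) ≤
      4 ^ p * ∫⁻ t in Ioc ((2 : ℝ) ^ (k - 1 - 1)) (2 ^ (k - 1)), f t := by
    intro k
    have hpos : (0 : ℝ) < 2 ^ (k - 1 - 1) := by positivity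
    have hlen : (2 : ℝ) ^ (k - 1) - 2 ^ (k - 1 - 1) = 2 ^ (k - 1 - 1) := by
      rw [zpow_sub_one₀ two_ne_zero (k - 1)]
      ring
    have hint : tail μ x₀ (2 ^ (k - 1)) ^ (1 / 2 : ℝ) *
        ENNReal.ofReal (((2 : ℝ) ^ (k - 1 - 1)) ^ p) ≤
        ∫⁻ t in Ioc ((2 : ℝ) ^ (k - 1 - 1)) (2 ^ (k - 1)), f t := by
      calc _ = ∫⁻ _ in Ioc ((2 : ℝ) ^ (k - 1 - 1)) (2 ^ (k - 1)),
            tail μ x₀ (2 ^ (k - 1)) ^ (1 / 2 : ℝ) *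
              ENNReal.ofReal (((2 : ℝ) ^ (k - 1 - 1)) ^ (p - 1)) := by
            rw [setLIntegral_const, Real.volume_Ioc, hlen, mul_assoc,
              ← ENNReal.ofReal_mul (by positivity), ← Real.rpow_add_one hpos.ne', sub_add_cancel]
        _ ≤ _ := by
            refine setLIntegral_mono' measurableSet_Ioc fun t ht => ?_
            refine mul_le_mul' (ENNReal.rpow_le_rpow (tail_anti μ x₀ ht.2) (by norm_num))
              (ENNReal.ofReal_le_ofReal (Real.rpow_le_rpow hpos.le ht.1.le (by linarith)))
    calc _ ≤ ENNReal.ofReal (((2 : ℝ) ^ k) ^ p) * tail μ x₀ (2 ^ (k - 1)) ^ (1 / 2 : ℝ) := by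
          rw [shellRadius_some_rpow hp0.le]
          gcongr
          exact shellMass_le_tail μ x₀ k
      _ = 4 ^ p * (tail μ x₀ (2 ^ (k - 1)) ^ (1 / 2 : ℝ) *
          ENNReal.ofReal (((2 : ℝ) ^ (k - 1 - 1)) ^ p)) := by
          have h4 : (2 : ℝ) ^ k = 4 * 2 ^ (k - 1 - 1) := by
            rw [zpow_sub_one₀ two_ne_zero, zpow_sub_one₀ two_ne_zero]
            ring
          rw [h4, Real.mul_rpow (by norm_num) hpos.le, ENNReal.ofReal_mul (by positivity),
            ← ENNReal.ofReal_rpow_of_nonneg (by norm_num) hp0.le, ENNReal.ofReal_ofNat]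
          ring
      _ ≤ _ := by gcongr
  refine (ENNReal.tsum_le_tsum hterm).trans ?_
  rw [ENNReal.tsum_mul_left]
  gcongr
  exact ((Equiv.subRight (1 : ℤ)).tsum_eq
    (fun k : ℤ => ∫⁻ t in Ioc ((2 : ℝ) ^ (k - 1)) (2 ^ k), f t)).le.trans
    (tsum_lintegral_Ioc_zpow_le f)

theorem tsum_sq_le_sq_tsum {κ : Type*} (a : κ → ℝ≥0∞) : ∑' k, a k ^ 2 ≤ (∑' k, a k) ^ 2 := by
  rw [sq (∑' k, a k), ← ENNReal.tsum_mul_right]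
  refine ENNReal.tsum_le_tsum fun k => ?_
  rw [sq]
  gcongr
  exact ENNReal.le_tsum k

/-- The part of the weights `r_k ^ p` carried by the shells of radius at most `T`. -/
noncomputable def innerWeight (p T : ℝ) (k : Option ℤ) : ℝ≥0∞ :=
  if (shellRadius k : ℝ) ≤ T then (shellRadius k : ℝ≥0∞) ^ p else 0

/-- The part of the weights `r_k ^ p` carried by the shells of radius larger than `T`. -/
noncomputable def outerWeight (p T : ℝ) (k : Option ℤ) : ℝ≥0∞ :=
  if (shellRadius k : ℝ) ≤ T then 0 else (shellRadius k : ℝ≥0∞) ^ p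

theorem innerWeight_add_outerWeight (p T : ℝ) (k : Option ℤ) :
    innerWeight p T k + outerWeight p T k = (shellRadius k : ℝ≥0∞) ^ p := by
  unfold innerWeight outerWeight
  split_ifs <;> simp

theorem innerWeight_le (p T : ℝ) (k : Option ℤ) :
    innerWeight p T k ≤ (shellRadius k : ℝ≥0∞) ^ p := by
  rw [← innerWeight_add_outerWeight p T]
  exact le_self_add

theorem innerWeight_le_ofReal {p T : ℝ} (hp : 0 ≤ p) (hT : 0 ≤ T) (k : Option ℤ) :
    innerWeight p T k ≤ ENNReal.ofReal (T ^ p) := by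
  unfold innerWeight
  split_ifs with h
  · rw [← ENNReal.ofReal_rpow_of_nonneg hT hp, ← ENNReal.ofReal_coe_nnreal]
    gcongr
  · exact zero_le

theorem shellMass_le_of_weakMoment (μ : Measure E) (x₀ : E) (q : ℝ) (k : ℤ) :
    shellMass μ x₀ (some k) ≤
      weakMoment q μ x₀ * ENNReal.ofReal (2 ^ q * ((2 : ℝ) ^ k) ^ (-q)) := by
  refine (shellMass_le_tail μ x₀ k).trans ((tail_le_of_weakMoment μ x₀ (q := q)
    (by positivity)).trans (le_of_eq ?_))
  rw [zpow_sub_one₀ two_ne_zero, Real.mul_rpow (by positivity) (by positivity),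
    Real.rpow_neg (x := (2 : ℝ)⁻¹) (by positivity), Real.inv_rpow (by positivity), inv_inv,
    mul_comm (2 ^ q)]

/-- The summand is of order `2 ^ (k * p * (1 - r / 2))`; since `r < 2` the largest admitted shell
dominates. -/
theorem tsum_innerWeight_mul_sqrt_le (μ : Measure E) (x₀ : E) {p r T : ℝ} (hp : 1 ≤ p)
    (hr : r < 2) (hT : 0 < T) :
    ∑' k, innerWeight p T k * shellMass μ x₀ k ^ (1 / 2 : ℝ) ≤
      weakMoment (r * p) μ x₀ ^ (1 / 2 : ℝ) * ENNReal.ofReal (2 ^ (r * p / 2) *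
        ((1 - 2 ^ (-(p * (1 - r / 2))))⁻¹ * T ^ (p * (1 - r / 2)))) := by
  have hp0 : 0 < p := by linarith
  have hc : 0 < p * (1 - r / 2) := by
    have : 0 < 1 - r / 2 := by linarith
    positivity
  rw [tsum_option_eq (by
    rw [nonpos_iff_eq_zero.1 ((innerWeight_le p T none).trans (shellRadius_none_rpow hp0).le),
      zero_mul])]
  have hterm : ∀ k : ℤ, innerWeight p T (some k) * shellMass μ x₀ (some k) ^ (1 / 2 : ℝ) ≤
      weakMoment (r * p) μ x₀ ^ (1 / 2 : ℝ) * ENNReal.ofReal (2 ^ (r * p / 2)) *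
      (if (2 : ℝ) ^ k ≤ T then ENNReal.ofReal (((2 : ℝ) ^ k) ^ (p * (1 - r / 2))) else 0) := by
    intro k
    have hs : ((shellRadius (some k) : ℝ≥0) : ℝ) = 2 ^ k := by simp [shellRadius]
    unfold innerWeight
    rw [hs]
    split_ifs with h
    · calc _ ≤ (shellRadius (some k) : ℝ≥0∞) ^ p * (weakMoment (r * p) μ x₀ *
            ENNReal.ofReal (2 ^ (r * p) * ((2 : ℝ) ^ k) ^ (-(r * p)))) ^ (1 / 2 : ℝ) := by
            gcongr
            exact shellMass_le_of_weakMoment μ x₀ (r * p) k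
        _ = _ := by
            have hpos : (0 : ℝ) < 2 ^ k := by positivity
            rw [shellRadius_some_rpow hp0.le, ENNReal.mul_rpow_of_nonneg _ _ (by norm_num),
              ENNReal.ofReal_rpow_of_nonneg (by positivity) (by norm_num),
              Real.mul_rpow (by positivity) (by positivity), ← Real.rpow_mul (by norm_num),
              ← Real.rpow_mul hpos.le, mul_left_comm,
              ← ENNReal.ofReal_mul (by positivity),
              mul_assoc (weakMoment (r * p) μ x₀ ^ (1 / 2 : ℝ)),
              ← ENNReal.ofReal_mul (by positivity)]
            congr 2
            rw [mul_left_comm, ← Real.rpow_add hpos]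
            ring_nf
    · rw [zero_mul]
      exact zero_le
  refine (ENNReal.tsum_le_tsum hterm).trans ?_
  rw [ENNReal.tsum_mul_left, mul_assoc, ENNReal.ofReal_mul (by positivity)]
  gcongr
  exact tsum_zpow_rpow_le_of_pos hc hT

/-- The summand is of order `2 ^ (k * p * (1 - r))`; since `1 < r` the smallest admitted shell
dominates. -/
theorem tsum_outerWeight_mul_le (μ : Measure E) (x₀ : E) {p r T : ℝ} (hp : 1 ≤ p)
    (hr : 1 < r) (hT : 0 < T) :
    ∑' k, outerWeight p T k * shellMass μ x₀ k ≤
      weakMoment (r * p) μ x₀ * ENNReal.ofReal (2 ^ (r * p) *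
        ((1 - 2 ^ (p * (1 - r)))⁻¹ * T ^ (p * (1 - r)))) := by
  have hp0 : 0 < p := by linarith
  have hc : p * (1 - r) < 0 := mul_neg_of_pos_of_neg hp0 (by linarith)
  rw [tsum_option_eq (by simp [outerWeight, shellRadius, hT.le])]
  have hterm : ∀ k : ℤ, outerWeight p T (some k) * shellMass μ x₀ (some k) ≤
      weakMoment (r * p) μ x₀ * ENNReal.ofReal (2 ^ (r * p)) *
      (if (2 : ℝ) ^ k ≤ T then 0 else ENNReal.ofReal (((2 : ℝ) ^ k) ^ (p * (1 - r)))) := by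
    intro k
    have hs : ((shellRadius (some k) : ℝ≥0) : ℝ) = 2 ^ k := by simp [shellRadius]
    unfold outerWeight
    rw [hs]
    split_ifs with h
    · rw [zero_mul]
      exact zero_le
    · calc _ ≤ (shellRadius (some k) : ℝ≥0∞) ^ p * (weakMoment (r * p) μ x₀ *
            ENNReal.ofReal (2 ^ (r * p) * ((2 : ℝ) ^ k) ^ (-(r * p)))) := by
            gcongr
            exact shellMass_le_of_weakMoment μ x₀ (r * p) k
        _ = _ := by
            have hpos : (0 : ℝ) < 2 ^ k := by positivity
            rw [shellRadius_some_rpow hp0.le, mul_left_comm, mul_assoc,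
              ← ENNReal.ofReal_mul (by positivity), ← ENNReal.ofReal_mul (by positivity)]
            congr 2
            rw [mul_left_comm, ← Real.rpow_add hpos]
            ring_nf
  refine (ENNReal.tsum_le_tsum hterm).trans ?_
  rw [ENNReal.tsum_mul_left, mul_assoc, ENNReal.ofReal_mul (by positivity)]
  gcongr
  exact tsum_zpow_rpow_le_of_neg hc hT

/-- On `(0, 1]` the integrand is at most one; beyond, the weak moment bounds it by a multiple of `t
^ (p * (1 - r / 2) - 1)`, integrable because `2 < r`. -/
theorem tailIntegral_ne_top (μ : Measure E) [IsProbabilityMeasure μ] (x₀ : E) {p r : ℝ}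
    (hp : 1 ≤ p) (hr : 2 < r) (hM : weakMoment (r * p) μ x₀ ≠ ∞) :
    tailIntegral p μ x₀ ≠ ∞ := by
  have hp0 : 0 < p := by linarith
  unfold tailIntegral
  rw [← Ioc_union_Ioi_eq_Ioi (zero_le_one' ℝ)]
  refine ne_top_of_le_ne_top ?_ (lintegral_union_le _ _ _)
  refine ENNReal.add_ne_top.2 ⟨?_, ?_⟩
  · refine ne_top_of_le_ne_top (b := ∫⁻ _ in Ioc (0 : ℝ) 1, (1 : ℝ≥0∞)) ?_ ?_
    · simp
    · refine setLIntegral_mono' measurableSet_Ioc fun t ht => ?_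
      refine mul_le_one' (ENNReal.rpow_le_one prob_le_one (by norm_num)) ?_
      rw [ENNReal.ofReal_le_one]
      exact Real.rpow_le_one ht.1.le ht.2 (by linarith)
  · have he : p * (1 - r / 2) - 1 < -1 := by
      have : p * (1 - r / 2) < 0 := mul_neg_of_pos_of_neg hp0 (by linarith)
      linarith
    have hint := (integrableOn_Ioi_rpow_of_lt he one_pos).lintegral_lt_top
    refine ne_top_of_le_ne_top (b := weakMoment (r * p) μ x₀ ^ (1 / 2 : ℝ) *
      ∫⁻ t in Ioi (1 : ℝ), ENNReal.ofReal (t ^ (p * (1 - r / 2) - 1)))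
      (ENNReal.mul_ne_top (ENNReal.rpow_ne_top_of_nonneg (by norm_num) hM) hint.ne) ?_
    rw [← lintegral_const_mul' _ _ (ENNReal.rpow_ne_top_of_nonneg (by norm_num) hM)]
    refine setLIntegral_mono' measurableSet_Ioi fun t ht => ?_
    have ht0 : (0 : ℝ) < t := one_pos.trans ht
    calc _ ≤ (weakMoment (r * p) μ x₀ * ENNReal.ofReal (t ^ (-(r * p)))) ^ (1 / 2 : ℝ) *
          ENNReal.ofReal (t ^ (p - 1)) := by
          gcongr
          exact tail_le_of_weakMoment μ x₀ ht0
      _ = _ := by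
          rw [ENNReal.mul_rpow_of_nonneg _ _ (by norm_num),
            ENNReal.ofReal_rpow_of_nonneg (by positivity) (by norm_num), ← Real.rpow_mul ht0.le,
            mul_assoc, ← ENNReal.ofReal_mul (by positivity), ← Real.rpow_add ht0]
          ring_nf

theorem strongMoment_le [BorelSpace E] (μ : Measure E) (x₀ : E) {p : ℝ} (hp : 0 ≤ p) :
    strongMoment p μ x₀ ≤ ∑' k, (shellRadius k : ℝ≥0∞) ^ p * shellMass μ x₀ k := by
  rw [← lintegral_shell μ x₀ fun k => (shellRadius k : ℝ≥0∞) ^ p]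
  refine lintegral_mono fun y => ?_
  dsimp only
  gcongr
  rw [edist_nndist]
  exact_mod_cast dist_le_shellRadius x₀ y

theorem tsum_shellRadius_mul_le_strongMoment [BorelSpace E] (μ : Measure E) (x₀ : E)
    {p : ℝ} (hp : 0 ≤ p) :
    ∑' k, (shellRadius k : ℝ≥0∞) ^ p * shellMass μ x₀ k ≤ 2 ^ p * strongMoment p μ x₀ := by
  rw [← lintegral_shell μ x₀ fun k => (shellRadius k : ℝ≥0∞) ^ p, strongMoment,
    ← lintegral_const_mul' _ _ (by simp)]
  refine lintegral_mono fun y => ?_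
  dsimp only
  rw [← ENNReal.mul_rpow_of_nonneg _ _ hp]
  gcongr
  rw [edist_nndist]
  exact_mod_cast shellRadius_le_two_mul_dist x₀ y

theorem le_rpow_half {a : ℝ≥0∞} (h : a ≤ 1) : a ≤ a ^ (1 / 2 : ℝ) := by
  conv_lhs => rw [← ENNReal.rpow_one a]
  exact ENNReal.rpow_le_rpow_of_exponent_ge h (by norm_num)

end ShellMass

/-! ### Weighted sums over the cells of all levels. -/

section Cells

variable {E : Type*}

/-- The cells of all levels up to `L`. -/
def cell (g : ℕ → E → Option ℤ × ℕ) (L : ℕ) (j : Fin (L + 1) × (Option ℤ × ℕ)) : Set E :=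
  g j.1 ⁻¹' {j.2}

/-- The weights of the cells of all levels up to `L`, for given weights of the shells. -/
noncomputable def cellWeight (p : ℝ) (L : ℕ) (a : Option ℤ → ℝ≥0∞)
    (j : Fin (L + 1) × (Option ℤ × ℕ)) : ℝ≥0∞ :=
  (2 ^ (-p)) ^ (j.1 : ℕ) * a j.2.1

theorem two_rpow_neg_le {p : ℝ} (hp : 1 ≤ p) : (2 : ℝ≥0∞) ^ (-p) ≤ 2⁻¹ := by
  rw [ENNReal.rpow_neg, ENNReal.inv_le_inv]
  calc (2 : ℝ≥0∞) = 2 ^ (1 : ℝ) := (ENNReal.rpow_one _).symm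
    _ ≤ 2 ^ p := ENNReal.rpow_le_rpow_of_exponent_le (by norm_num) hp

theorem sum_two_rpow_neg_pow_le {p : ℝ} (hp : 1 ≤ p) (L : ℕ) :
    ∑ l : Fin (L + 1), ((2 : ℝ≥0∞) ^ (-p)) ^ (l : ℕ) ≤ 2 := by
  rw [Fin.sum_univ_eq_sum_range fun l => ((2 : ℝ≥0∞) ^ (-p)) ^ l]
  calc _ ≤ ∑ l ∈ Finset.range (L + 1), (2⁻¹ : ℝ≥0∞) ^ l := by
        gcongr
        exact two_rpow_neg_le hp
    _ ≤ ∑' l : ℕ, (2⁻¹ : ℝ≥0∞) ^ l := ENNReal.sum_le_tsum _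
    _ = 2 := by rw [ENNReal.tsum_geometric, ENNReal.one_sub_inv_two, inv_inv]

/-- A point lies in exactly one cell per level, and the level weights sum to at most 2 because `1 ≤
p`. -/
theorem tsum_cellWeight_mul_indicator_le {p : ℝ} (hp : 1 ≤ p) (L : ℕ) (a : Option ℤ → ℝ≥0∞)
    (g : ℕ → E → Option ℤ × ℕ) (s : E → Option ℤ) (hs : ∀ l y, (g l y).1 = s y) (y : E) :
    ∑' j, cellWeight p L a j * (cell g L j).indicator 1 y ≤ 2 * a (s y) := by
  rw [ENNReal.tsum_prod', tsum_fintype]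
  have h : ∀ l : Fin (L + 1), ∑' i, cellWeight p L a (l, i) * (cell g L (l, i)).indicator 1 y =
      (2 ^ (-p)) ^ (l : ℕ) * a (s y) := by
    intro l
    rw [tsum_eq_single (g l y)]
    · simp [cellWeight, cell, hs]
    · intro i hi
      rw [indicator_of_notMem, mul_zero]
      simpa [cell] using hi.symm
  simp_rw [h]
  rw [← Finset.sum_mul]
  gcongr
  exact sum_two_rpow_neg_pow_le hp L

/-- The constant that collects the entropy of the nets of all levels. -/
noncomputable def entropyConst (p α β : ℝ) : ℝ≥0∞ :=
  ∑' l : ℕ, (2 ^ (-p)) ^ l * ((netCard α β l + 1 : ℕ) : ℝ≥0∞) ^ (1 / 2 : ℝ)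

/-- The nets grow like `2 ^ (α * l)`, so the terms are of order `2 ^ ((α / 2 - p) * l)`: summable
precisely because `α < 2 * p`. -/
theorem entropyConst_ne_top {p α β : ℝ} (hα : 0 < α) (hαp : α < 2 * p) (hβ : 0 < β) :
    entropyConst p α β ≠ ∞ := by
  set ρ : ℝ := 2 ^ (α / 2 - p)
  have hρ0 : 0 ≤ ρ := by positivity
  have hρ1 : ρ < 1 := Real.rpow_lt_one_of_one_lt_of_neg one_lt_two (by linarith)
  set C : ℝ := (β * 2 ^ α + 2) ^ (1 / 2 : ℝ)
  have hC : 0 ≤ C := by positivity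
  have hterm : ∀ l : ℕ, ((2 : ℝ≥0∞) ^ (-p)) ^ l *
      ((netCard α β l + 1 : ℕ) : ℝ≥0∞) ^ (1 / 2 : ℝ) ≤ ENNReal.ofReal (C * ρ ^ l) := by
    intro l
    have h1 : ((netCard α β l + 1 : ℕ) : ℝ) ≤ (β * 2 ^ α + 2) * (2 ^ α) ^ l := by
      have h2 : (⌊β * ((2 : ℝ) ^ (l + 1)) ^ α⌋₊ : ℝ) ≤ β * ((2 : ℝ) ^ (l + 1)) ^ α :=
        Nat.floor_le (by positivity)
      have h3 : ((2 : ℝ) ^ (l + 1)) ^ α = 2 ^ α * (2 ^ α) ^ l := by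
        rw [← pow_succ', ← Real.rpow_natCast, ← Real.rpow_natCast, ← Real.rpow_mul (by norm_num),
          ← Real.rpow_mul (by norm_num), mul_comm]
      have h4 : (1 : ℝ) ≤ (2 ^ α) ^ l := one_le_pow₀ (Real.one_le_rpow one_le_two hα.le)
      rw [h3] at h2
      simp only [netCard]
      push_cast
      rw [h3]
      nlinarith
    have h5 : (2 : ℝ≥0∞) ^ (-p) = ENNReal.ofReal (2 ^ (-p)) := by
      rw [← ENNReal.ofReal_rpow_of_pos two_pos, ENNReal.ofReal_ofNat]
    rw [h5, ← ENNReal.ofReal_pow (by positivity), ← ENNReal.ofReal_natCast,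
      ENNReal.ofReal_rpow_of_nonneg (by positivity) (by norm_num),
      ← ENNReal.ofReal_mul (by positivity)]
    refine ENNReal.ofReal_le_ofReal ?_
    calc _ ≤ ((2 : ℝ) ^ (-p)) ^ l * ((β * 2 ^ α + 2) * (2 ^ α) ^ l) ^ (1 / 2 : ℝ) := by gcongr
      _ = C * ρ ^ l := by
        have h6 : ρ = 2 ^ (-p) * 2 ^ (α / 2) := by
          simp only [ρ]
          rw [← Real.rpow_add two_pos]
          ring_nf
        have h7 : (((2 : ℝ) ^ α) ^ l) ^ (1 / 2 : ℝ) = (2 ^ (α / 2)) ^ l := by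
          rw [← Real.rpow_natCast, ← Real.rpow_natCast, ← Real.rpow_mul (by positivity),
            ← Real.rpow_mul (by positivity), ← Real.rpow_mul (by norm_num)]
          ring_nf
        rw [Real.mul_rpow (by positivity) (by positivity), h7, h6, mul_pow]
        ring
  refine ne_top_of_le_ne_top ?_ (ENNReal.tsum_le_tsum hterm)
  rw [← ENNReal.ofReal_tsum_of_nonneg (fun l => by positivity)
    ((summable_geometric_of_lt_one hρ0 hρ1).mul_left _)]
  exact ENNReal.ofReal_ne_top

variable [MeasurableSpace E]

theorem measurableSet_cell {g : ℕ → E → Option ℤ × ℕ} (hg : ∀ l, Measurable (g l)) (L : ℕ)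
    (j : Fin (L + 1) × (Option ℤ × ℕ)) : MeasurableSet (cell g L j) :=
  hg _ (measurableSet_singleton _)

variable [MetricSpace E]

theorem tsum_cellWeight_mul_le [BorelSpace E] (μ : Measure E) {x₀ : E} {p : ℝ} (hp : 1 ≤ p) (L : ℕ)
    (a : Option ℤ → ℝ≥0∞) {g : ℕ → E → Option ℤ × ℕ} (hg : ∀ l, Measurable (g l))
    (hs : ∀ l y, (g l y).1 = shell x₀ y) :
    ∑' j, cellWeight p L a j * μ (cell g L j) ≤ 2 * ∑' k, a k * shellMass μ x₀ k := by
  have ham : Measurable fun y => a (shell x₀ y) :=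
    (Measurable.of_discrete (f := a)).comp (measurable_shell x₀)
  rw [← lintegral_shell μ x₀ a, ← lintegral_const_mul _ ham]
  calc _ = ∫⁻ y, ∑' j, cellWeight p L a j * (cell g L j).indicator 1 y ∂μ := by
        rw [lintegral_tsum fun j =>
          ((measurable_one.indicator (measurableSet_cell hg L j)).const_mul _).aemeasurable]
        refine tsum_congr fun j => ?_
        rw [lintegral_const_mul _ (measurable_one.indicator (measurableSet_cell hg L j)),
          lintegral_indicator_one (measurableSet_cell hg L j)]
    _ ≤ _ := lintegral_mono fun y => tsum_cellWeight_mul_indicator_le hp L a g _ hs y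

/-- Cauchy-Schwarz over the cells of one shell. Labels run from `0` to `netCard` inclusive, the last
being the default of `firstNear`, hence the `+ 1`. -/
theorem tsum_sqrt_cell_le (μ : Measure E) {x₀ : E} {α β : ℝ}
    {g : ℕ → E → Option ℤ × ℕ} (hg : ∀ l, Measurable (g l))
    (hs : ∀ l y, (g l y).1 = shell x₀ y) (hN : ∀ l y, (g l y).2 ≤ netCard α β l) (l : ℕ)
    (k : Option ℤ) :
    ∑' j : ℕ, μ (g l ⁻¹' {(k, j)}) ^ (1 / 2 : ℝ) ≤
      ((netCard α β l + 1 : ℕ) : ℝ≥0∞) ^ (1 / 2 : ℝ) * shellMass μ x₀ k ^ (1 / 2 : ℝ) := by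
  rw [tsum_eq_sum (s := Finset.range (netCard α β l + 1))]
  · have h := ENNReal.inner_le_Lp_mul_Lq (Finset.range (netCard α β l + 1)) (fun _ => 1)
      (fun j => μ (g l ⁻¹' {(k, j)}) ^ (1 / 2 : ℝ)) Real.HolderConjugate.two_two
    simp only [one_mul, ENNReal.one_rpow, Finset.sum_const, Finset.card_range, nsmul_eq_mul,
      mul_one, ← ENNReal.rpow_mul] at h
    norm_num at h
    refine h.trans ?_
    push_cast
    gcongr ?_ * ?_ ^ (1 / 2 : ℝ)
    · norm_num
    rw [shellMass, ← measure_biUnion_finset]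
    · refine measure_mono (iUnion₂_subset fun j _ y hy => ?_)
      simp only [mem_preimage, mem_singleton_iff] at hy ⊢
      rw [← hs l y, hy]
    · intro i _ j _ hij
      exact pairwise_disjoint_fiber (g l) fun h => hij (Prod.mk.inj h).2
    · exact fun j _ => hg l (measurableSet_singleton _)
  · intro j hj
    have : g l ⁻¹' {(k, j)} = ∅ := by
      ext y
      simp only [mem_preimage, mem_singleton_iff, mem_empty_iff_false, iff_false]
      intro h
      have h2 := hN l y
      rw [h] at h2
      exact hj (Finset.mem_range.2 (Nat.lt_succ_of_le h2))
    rw [this, measure_empty, ENNReal.zero_rpow_of_pos (by norm_num)]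

theorem tsum_cellWeight_mul_sqrt_le (μ : Measure E) {x₀ : E} {p α β : ℝ} (L : ℕ)
    (a : Option ℤ → ℝ≥0∞) {g : ℕ → E → Option ℤ × ℕ} (hg : ∀ l, Measurable (g l))
    (hs : ∀ l y, (g l y).1 = shell x₀ y) (hN : ∀ l y, (g l y).2 ≤ netCard α β l) :
    ∑' j, cellWeight p L a j * μ (cell g L j) ^ (1 / 2 : ℝ) ≤
      entropyConst p α β * ∑' k, a k * shellMass μ x₀ k ^ (1 / 2 : ℝ) := by
  rw [ENNReal.tsum_prod', tsum_fintype, entropyConst]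
  calc _ ≤ ∑ l : Fin (L + 1), (2 ^ (-p)) ^ (l : ℕ) *
        ((netCard α β l + 1 : ℕ) : ℝ≥0∞) ^ (1 / 2 : ℝ) *
        ∑' k, a k * shellMass μ x₀ k ^ (1 / 2 : ℝ) := by
        refine Finset.sum_le_sum fun l _ => ?_
        rw [ENNReal.tsum_prod', ← ENNReal.tsum_mul_left]
        refine ENNReal.tsum_le_tsum fun k => ?_
        simp only [cellWeight, cell]
        rw [ENNReal.tsum_mul_left]
        calc _ ≤ (2 ^ (-p)) ^ (l : ℕ) * a k * (((netCard α β l + 1 : ℕ) : ℝ≥0∞) ^ (1 / 2 : ℝ) *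
              shellMass μ x₀ k ^ (1 / 2 : ℝ)) := by
              gcongr
              exact tsum_sqrt_cell_le μ hg hs hN l k
          _ = _ := by ring
    _ ≤ _ := by
        rw [← Finset.sum_mul]
        gcongr
        rw [Fin.sum_univ_eq_sum_range fun l => ((2 : ℝ≥0∞) ^ (-p)) ^ l *
          ((netCard α β l + 1 : ℕ) : ℝ≥0∞) ^ (1 / 2 : ℝ)]
        exact ENNReal.sum_le_tsum _

end Cells

/-! ### From the transport cost of the sample to cell deviations. -/

section Sample

variable {E : Type*} [MeasurableSpace E]

theorem isProbabilityMeasure_empiricalMeasure {n : ℕ} (hn : 1 ≤ n) (x : Fin n → E) :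
    IsProbabilityMeasure (empiricalMeasure x) := by
  constructor
  rw [empiricalMeasure_apply x MeasurableSet.univ]
  simp only [indicator_univ, Pi.one_apply, Finset.sum_const, Finset.card_univ, Fintype.card_fin,
    nsmul_eq_mul, mul_one]
  exact ENNReal.inv_mul_cancel (by simp; omega) (by simp)

/-- The tail of the transport cost of an i.i.d. sample is controlled by the tails of weighted
deviations of the empirical measure on cells. -/
theorem exists_measure_wassersteinPow_le [MetricSpace E] [BorelSpace E] {S : Set E} {x₀ : E}
    {α β p : ℝ} (hp : 1 ≤ p)
    (h : UniformCovering S x₀ α β) {Ω : Type*} [MeasurableSpace Ω] {P : Measure Ω}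
    [IsProbabilityMeasure P] {μ : Measure E} [IsProbabilityMeasure μ] {n : ℕ} (hn : 1 ≤ n)
    {X : Fin n → Ω → E} (hX : ∀ i, Measurable (X i)) (hind : iIndepFun X P)
    (hlaw : ∀ i, P.map (X i) = μ) (hS : ∀ᵐ y ∂μ, y ∈ S)
    (hV : ∑' k, (shellRadius k : ℝ≥0∞) ^ p * shellMass μ x₀ k ≠ ∞) {y : ℝ} (hy : 0 < y) :
    ∃ (L : ℕ) (g : ℕ → E → Option ℤ × ℕ), (∀ l, Measurable (g l)) ∧
      (∀ l y, (g l y).1 = shell x₀ y) ∧ (∀ l y, (g l y).2 ≤ netCard α β l) ∧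
      ∀ a a' : Option ℤ → ℝ≥0∞, (∀ k, a k + a' k = (shellRadius k : ℝ≥0∞) ^ p) →
        P.real {ω | ENNReal.ofReal (8 ^ p * (4 * y)) <
          wassersteinPow p μ (empiricalMeasure fun i => X i ω)} ≤
        (Measure.pi fun _ : Fin n => μ).real
          {z | ENNReal.ofReal (2 * y) ≤ deviation (cellWeight p L a) (cell g L) μ z} +
        (Measure.pi fun _ : Fin n => μ).real
          {z | ENNReal.ofReal y ≤ deviation (cellWeight p L a') (cell g L) μ z} := by
  set V := ∑' k, (shellRadius k : ℝ≥0∞) ^ p * shellMass μ x₀ k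
  have hp0 : 0 ≤ p := by linarith
  -- The depth depends on `μ` and `y`, which is harmless: all bounds on the deviations are uniform
  -- in `L`.
  obtain ⟨L, hL⟩ : ∃ L : ℕ, ((2 : ℝ≥0∞) ^ (-p)) ^ L * V ≤ ENNReal.ofReal y := by
    have ht : Filter.Tendsto (fun L : ℕ => ((2 : ℝ≥0∞) ^ (-p)) ^ L * V) Filter.atTop
        (nhds (0 * V)) := by
      refine ENNReal.Tendsto.mul_const ?_ (Or.inr hV)
      refine ENNReal.tendsto_pow_atTop_nhds_zero_of_lt_one ?_
      exact (two_rpow_neg_le hp).trans_lt (by norm_num)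
    rw [zero_mul] at ht
    exact (ht.eventually (ge_mem_nhds (ENNReal.ofReal_pos.2 hy))).exists
  obtain ⟨g, hg, hs, hN, hW⟩ := exists_cells hp h L
  refine ⟨L, g, hg, hs, hN, fun a a' ha => ?_⟩
  have hmap : P.map (fun ω i => X i ω) = Measure.pi fun _ : Fin n => μ := by
    rw [(iIndepFun_iff_map_fun_eq_pi_map fun i => (hX i).aemeasurable).1 hind]
    simp_rw [hlaw]
  have hXm : Measurable fun ω i => X i ω := measurable_pi_lambda _ hX
  have hSX : ∀ᵐ ω ∂P, ∀ i, X i ω ∈ S := by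
    rw [ae_all_iff]
    intro i
    rw [← hlaw i] at hS
    exact ae_of_ae_map (hX i).aemeasurable hS
  have hdm : ∀ (b : Option ℤ → ℝ≥0∞) (t : ℝ≥0∞), MeasurableSet {z : Fin n → E |
      t ≤ deviation (cellWeight p L b) (cell g L) μ z} := fun b t =>
    measurableSet_le measurable_const (measurable_deviation _ (measurableSet_cell hg L) μ)
  have hsub : ∀ᵐ ω ∂P, ω ∈ {ω | ENNReal.ofReal (8 ^ p * (4 * y)) <
      wassersteinPow p μ (empiricalMeasure fun i => X i ω)} →
      ω ∈ (fun ω i => X i ω) ⁻¹' ({z | ENNReal.ofReal (2 * y) ≤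
        deviation (cellWeight p L a) (cell g L) μ z} ∪
        {z | ENNReal.ofReal y ≤ deviation (cellWeight p L a') (cell g L) μ z}) := by
    filter_upwards [hSX] with ω hω hlt
    have hprob := isProbabilityMeasure_empiricalMeasure hn fun i => X i ω
    have hemp : ∀ᵐ z ∂(empiricalMeasure fun i => X i ω), z ∈ S := by
      refine Measure.ae_smul_measure ?_ _
      rw [← Measure.sum_fintype]
      rw [Measure.ae_sum_iff]
      intro i
      rw [ae_dirac_eq]
      exact hω i
    have hle := hW μ (empiricalMeasure fun i => X i ω) hS hemp
    rw [lintegral_shell μ x₀ fun k => (shellRadius k : ℝ≥0∞) ^ p] at hle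
    have hdev : ∑ l ∈ Finset.range (L + 1), ((2 : ℝ≥0∞) ^ (-p)) ^ l * ∑' i : Option ℤ × ℕ,
        (shellRadius i.1 : ℝ≥0∞) ^ p * absDiff (μ (g l ⁻¹' {i}))
          (empiricalMeasure (fun i => X i ω) (g l ⁻¹' {i})) =
        deviation (cellWeight p L a) (cell g L) μ (fun i => X i ω) +
        deviation (cellWeight p L a') (cell g L) μ (fun i => X i ω) := by
      unfold deviation
      rw [← ENNReal.tsum_add, ENNReal.tsum_prod', tsum_fintype]
      rw [← Fin.sum_univ_eq_sum_range (fun l => ((2 : ℝ≥0∞) ^ (-p)) ^ l * ∑' i : Option ℤ × ℕ,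
        (shellRadius i.1 : ℝ≥0∞) ^ p * absDiff (μ (g l ⁻¹' {i}))
          (empiricalMeasure (fun i => X i ω) (g l ⁻¹' {i})))]
      refine Finset.sum_congr rfl fun l _ => ?_
      rw [← ENNReal.tsum_mul_left]
      refine tsum_congr fun i => ?_
      simp only [cellWeight, cell, ← ha]
      ring
    rw [hdev] at hle
    by_contra hcon
    simp only [mem_preimage, mem_union, mem_ofPred_eq, not_or, not_le] at hcon
    refine absurd hlt (not_lt.2 (hle.trans ?_))
    rw [ENNReal.ofReal_mul (by positivity), ← ENNReal.ofReal_rpow_of_pos (by norm_num),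
      ENNReal.ofReal_ofNat]
    gcongr
    -- One `y` for the finest level, `2 * y` for the first piece and `y` for the second. The first
    -- piece gets more so that a mean of size `y` can be absorbed.
    calc _ ≤ ENNReal.ofReal y + (ENNReal.ofReal (2 * y) + ENNReal.ofReal y) :=
          add_le_add hL (add_le_add hcon.1.le hcon.2.le)
      _ = ENNReal.ofReal (4 * y) := by
          rw [← ENNReal.ofReal_add (by positivity) hy.le,
            ← ENNReal.ofReal_add hy.le (by positivity)]
          ring_nf
  -- Only the deviation events have to be measurable; monotonicity of outer measure handles the
  -- event on the transport cost.
  have h1 : P {ω | ENNReal.ofReal (8 ^ p * (4 * y)) <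
      wassersteinPow p μ (empiricalMeasure fun i => X i ω)} ≤
      (Measure.pi fun _ : Fin n => μ) ({z | ENNReal.ofReal (2 * y) ≤
        deviation (cellWeight p L a) (cell g L) μ z} ∪
        {z | ENNReal.ofReal y ≤ deviation (cellWeight p L a') (cell g L) μ z}) := by
    rw [← hmap, Measure.map_apply hXm ((hdm a _).union (hdm a' _))]
    exact measure_mono_ae hsub
  refine le_trans ?_ (measureReal_union_le _ _)
  exact ENNReal.toReal_mono (measure_ne_top _ _) h1

end Sample

/-! ### Chebyshev, Markov and Fuk-Nagaev bounds for cell deviations. -/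

section CellDeviation

variable {E : Type*} [MetricSpace E] [MeasurableSpace E] (μ : Measure E)
  [IsProbabilityMeasure μ] {x₀ : E} {p α β : ℝ} (L : ℕ) (a : Option ℤ → ℝ≥0∞)
  {g : ℕ → E → Option ℤ × ℕ} {n : ℕ}

theorem lintegral_cellDeviation_le_mul (hn : 1 ≤ n) (hg : ∀ l, Measurable (g l))
    (hs : ∀ l y, (g l y).1 = shell x₀ y) (hN : ∀ l y, (g l y).2 ≤ netCard α β l) {c s : ℝ}
    (hc : 0 ≤ c) (hcE : entropyConst p α β ≤ ENNReal.ofReal c)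
    (hsE : ∑' k, a k * shellMass μ x₀ k ^ (1 / 2 : ℝ) ≤ ENNReal.ofReal s) :
    ∫⁻ x, deviation (cellWeight p L a) (cell g L) μ x ∂(Measure.pi fun _ : Fin n => μ) ≤
      ENNReal.ofReal (c * s / √n) := by
  have hn0 : (0 : ℝ) < n := by exact_mod_cast hn
  calc _ ≤ _ := lintegral_deviation_le μ _ (measurableSet_cell hg L) hn
    _ ≤ ENNReal.ofReal c * ENNReal.ofReal s * ENNReal.ofReal (√n)⁻¹ := by
        refine mul_le_mul' ((tsum_cellWeight_mul_sqrt_le μ L a hg hs hN).trans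
          (mul_le_mul' hcE hsE)) (le_of_eq ?_)
        rw [ENNReal.ofReal_inv_of_pos (by positivity), Real.sqrt_eq_rpow,
          ← ENNReal.ofReal_rpow_of_pos hn0, ENNReal.ofReal_natCast, ENNReal.inv_rpow]
    _ = _ := by
        rw [← ENNReal.ofReal_mul hc, ← ENNReal.ofReal_mul' (by positivity), div_eq_mul_inv]

theorem measure_cellDeviation_ge_le_sq (hn : 1 ≤ n) (hg : ∀ l, Measurable (g l))
    (hs : ∀ l y, (g l y).1 = shell x₀ y) (hN : ∀ l y, (g l y).2 ≤ netCard α β l) {c s y : ℝ}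
    (hc : 0 ≤ c) (hy : 0 < y) (hcE : entropyConst p α β ≤ ENNReal.ofReal c)
    (hs0 : 0 ≤ s) (hsE : ∑' k, a k * shellMass μ x₀ k ^ (1 / 2 : ℝ) ≤ ENNReal.ofReal s) :
    (Measure.pi fun _ : Fin n => μ).real
      {z | ENNReal.ofReal (2 * y) ≤ deviation (cellWeight p L a) (cell g L) μ z} ≤
      (c * s) ^ 2 / (n * y ^ 2) := by
  have hn0 : (0 : ℝ) < n := by exact_mod_cast hn
  have hm := measurable_deviation (cellWeight p L a) (measurableSet_cell hg L) μ (n := n)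
  have h1 : (Measure.pi fun _ : Fin n => μ)
      {z | ENNReal.ofReal (2 * y) ≤ deviation (cellWeight p L a) (cell g L) μ z} ≤
      ENNReal.ofReal ((c * s) ^ 2 / (n * y ^ 2)) := by
    calc _ ≤ (Measure.pi fun _ : Fin n => μ) {z | ENNReal.ofReal (y ^ 2) ≤
          deviation (cellWeight p L a) (cell g L) μ z ^ 2} := by
          refine measure_mono fun z hz => ?_
          change ENNReal.ofReal (y ^ 2) ≤ deviation (cellWeight p L a) (cell g L) μ z ^ 2
          rw [ENNReal.ofReal_pow hy.le]
          gcongr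
          refine le_trans (ENNReal.ofReal_le_ofReal (by linarith)) hz
      _ ≤ _ := meas_ge_le_lintegral_div (hm.pow_const 2).aemeasurable
          (by simpa using hy.ne') ENNReal.ofReal_ne_top
      _ ≤ ENNReal.ofReal ((c * s) ^ 2 / n) / ENNReal.ofReal (y ^ 2) := by
          refine ENNReal.div_le_div ?_ le_rfl
          refine (lintegral_deviation_sq_le μ _ (measurableSet_cell hg L) hn).trans ?_
          rw [ENNReal.ofReal_div_of_pos hn0, ENNReal.ofReal_natCast, div_eq_mul_inv,
            ENNReal.ofReal_pow (by positivity), ENNReal.ofReal_mul hc]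
          exact mul_le_mul' (pow_le_pow_left' ((tsum_cellWeight_mul_sqrt_le μ L a hg hs hN).trans
            (mul_le_mul' hcE hsE)) 2) le_rfl
      _ = _ := by
          rw [← ENNReal.ofReal_div_of_pos (by positivity), div_div]
  exact ENNReal.toReal_le_of_le_ofReal (by positivity) h1

variable [BorelSpace E]

theorem lintegral_cellDeviation_le (hp : 1 ≤ p) (hn : 1 ≤ n) (hg : ∀ l, Measurable (g l))
    (hs : ∀ l y, (g l y).1 = shell x₀ y) {s : ℝ}
    (hsE : ∑' k, a k * shellMass μ x₀ k ≤ ENNReal.ofReal s) :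
    ∫⁻ x, deviation (cellWeight p L a) (cell g L) μ x ∂(Measure.pi fun _ : Fin n => μ) ≤
      ENNReal.ofReal (4 * s) := by
  calc _ ≤ _ := lintegral_deviation_le_two_mul μ _ (measurableSet_cell hg L) hn
    _ ≤ 2 * (2 * ENNReal.ofReal s) := by
        gcongr
        exact (tsum_cellWeight_mul_le μ hp L a hg hs).trans (mul_le_mul' le_rfl hsE)
    _ = _ := by
        rw [← mul_assoc, ENNReal.ofReal_mul (by norm_num), ENNReal.ofReal_ofNat]
        norm_num

theorem measure_cellDeviation_ge_le (hp : 1 ≤ p) (hn : 1 ≤ n) (hg : ∀ l, Measurable (g l))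
    (hs : ∀ l y, (g l y).1 = shell x₀ y) {s y : ℝ} (hs0 : 0 ≤ s) (hy : 0 < y)
    (hsE : ∑' k, a k * shellMass μ x₀ k ≤ ENNReal.ofReal s) :
    (Measure.pi fun _ : Fin n => μ).real
      {z | ENNReal.ofReal y ≤ deviation (cellWeight p L a) (cell g L) μ z} ≤ 4 * s / y := by
  have hm := measurable_deviation (cellWeight p L a) (measurableSet_cell hg L) μ (n := n)
  refine ENNReal.toReal_le_of_le_ofReal (by positivity) ?_
  rw [ENNReal.ofReal_div_of_pos hy]
  refine (meas_ge_le_lintegral_div hm.aemeasurable (by simpa using hy)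
    ENNReal.ofReal_ne_top).trans ?_
  gcongr
  exact lintegral_cellDeviation_le μ L a hp hn hg hs hsE

/-- The influence function is `h = 2 * a` on each shell. The bound `hab` is the boundedness that the
Bennett inequality needs, and `∫ h ^ 2` is at most `4 * s ^ 2` because a sum of squares is at most
the square of the sum. -/
theorem measure_cellDeviation_ge_le_rpow (hp : 1 ≤ p) (hn : 1 ≤ n) (hg : ∀ l, Measurable (g l))
    (hs : ∀ l y, (g l y).1 = shell x₀ y) {s y q : ℝ} (hs0 : 0 < s) (hy : 0 < y) (hq : 0 < q)
    (ha : ∀ k, a k ≤ (shellRadius k : ℝ≥0∞) ^ p)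
    (hab : ∀ k, a k ≤ ENNReal.ofReal (n * y / (3 * q)))
    (hsE : ∑' k, (shellRadius k : ℝ≥0∞) ^ p * shellMass μ x₀ k ^ (1 / 2 : ℝ) ≤ ENNReal.ofReal s)
    (hmean : ∫⁻ x, deviation (cellWeight p L a) (cell g L) μ x
      ∂(Measure.pi fun _ : Fin n => μ) ≤ ENNReal.ofReal y) :
    (Measure.pi fun _ : Fin n => μ).real
      {z | ENNReal.ofReal (2 * y) ≤ deviation (cellWeight p L a) (cell g L) μ z} ≤
      Real.exp (3 * q / 2) * (12 * q * (4 * s ^ 2 / n) / y ^ 2) ^ (q / 2) := by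
  have hn0 : (0 : ℝ) < n := by exact_mod_cast hn
  have hfin : ∀ k, 2 * a k ≠ ∞ := fun k =>
    ENNReal.mul_ne_top (by norm_num) (ne_top_of_le_ne_top ENNReal.ofReal_ne_top (hab k))
  set h : E → ℝ := fun z => (2 * a (shell x₀ z)).toReal
  have hh : Measurable h :=
    (Measurable.of_discrete (f := fun k => (2 * a k).toReal)).comp (measurable_shell x₀)
  refine measure_deviation_ge_le μ (cellWeight p L a) (measurableSet_cell hg L) hn hh
    (fun _ => ENNReal.toReal_nonneg) (fun z => ?_) hq hy (by positivity) (fun z => ?_) ?_ hmean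
  · rw [ENNReal.ofReal_toReal (hfin _)]
    exact tsum_cellWeight_mul_indicator_le hp L a g _ hs z
  · refine ENNReal.toReal_le_of_le_ofReal (by positivity) ?_
    calc 2 * a (shell x₀ z) ≤ 2 * ENNReal.ofReal (n * y / (3 * q)) := by
          gcongr
          exact hab _
      _ = _ := by
          rw [← ENNReal.ofReal_ofNat, ← ENNReal.ofReal_mul (by norm_num)]
          ring_nf
  · rw [integral_eq_lintegral_of_nonneg_ae (ae_of_all _ fun z => sq_nonneg _)
      (hh.pow_const 2).aestronglyMeasurable]
    refine ENNReal.toReal_le_of_le_ofReal (by positivity) ?_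
    calc ∫⁻ z, ENNReal.ofReal (h z ^ 2) ∂μ = ∫⁻ z, (2 * a (shell x₀ z)) ^ 2 ∂μ := by
          refine lintegral_congr fun z => ?_
          rw [ENNReal.ofReal_pow ENNReal.toReal_nonneg, ENNReal.ofReal_toReal (hfin _)]
      _ = ∑' k, (2 * a k) ^ 2 * shellMass μ x₀ k :=
          lintegral_shell μ x₀ fun k => (2 * a k) ^ 2
      _ ≤ ∑' k, 4 * ((shellRadius k : ℝ≥0∞) ^ p * shellMass μ x₀ k ^ (1 / 2 : ℝ)) ^ 2 := by
          refine ENNReal.tsum_le_tsum fun k => ?_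
          have e : (shellMass μ x₀ k ^ (1 / 2 : ℝ)) ^ 2 = shellMass μ x₀ k := by
            rw [← ENNReal.rpow_two, ← ENNReal.rpow_mul]
            norm_num
          rw [mul_pow, mul_pow, e, mul_assoc]
          gcongr
          · norm_num
          · exact ha k
      _ ≤ 4 * ENNReal.ofReal s ^ 2 := by
          rw [ENNReal.tsum_mul_left]
          gcongr
          exact (tsum_sq_le_sq_tsum _).trans (by gcongr)
      _ = _ := by
          rw [← ENNReal.ofReal_pow hs0.le, ← ENNReal.ofReal_ofNat,
            ← ENNReal.ofReal_mul (by norm_num)]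
          congr 1
          field_simp

end CellDeviation

/-! ### The three regimes. -/

section Regimes

variable {E : Type*} [MetricSpace E] [MeasurableSpace E] {S : Set E} {x₀ : E}
  {α β p : ℝ} {Ω : Type*} [MeasurableSpace Ω] {P : Measure Ω} [IsProbabilityMeasure P]
  {μ : Measure E} {n : ℕ} {X : Fin n → Ω → E}

theorem tsum_shellRadius_mul_sqrt_le_ofReal (hp : 1 ≤ p) (hI : tailIntegral p μ x₀ ≠ ∞) :
    ∑' k, (shellRadius k : ℝ≥0∞) ^ p * shellMass μ x₀ k ^ (1 / 2 : ℝ) ≤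
      ENNReal.ofReal (4 ^ p * (tailIntegral p μ x₀).toReal) := by
  refine (tsum_shellRadius_mul_sqrt_le μ x₀ hp).trans (le_of_eq ?_)
  rw [ENNReal.ofReal_mul (by positivity), ENNReal.ofReal_toReal hI,
    ← ENNReal.ofReal_rpow_of_pos (by norm_num), ENNReal.ofReal_ofNat]

/-- The constant of the contribution of the inner shells. -/
noncomputable def innerConst (p r : ℝ) : ℝ :=
  2 ^ (r * p / 2) * (1 - 2 ^ (-(p * (1 - r / 2))))⁻¹

/-- The constant of the contribution of the outer shells. -/
noncomputable def outerConst (p r : ℝ) : ℝ := 2 ^ (r * p) * (1 - 2 ^ (p * (1 - r)))⁻¹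

theorem innerConst_pos {p r : ℝ} (hp : 1 ≤ p) (hr : r < 2) : 0 < innerConst p r := by
  have : (2 : ℝ) ^ (-(p * (1 - r / 2))) < 1 := by
    refine Real.rpow_lt_one_of_one_lt_of_neg one_lt_two (neg_lt_zero.2 ?_)
    exact mul_pos (by linarith) (by linarith)
  have : 0 < 1 - (2 : ℝ) ^ (-(p * (1 - r / 2))) := by linarith
  unfold innerConst
  positivity

theorem outerConst_pos {p r : ℝ} (hp : 1 ≤ p) (hr : 1 < r) : 0 < outerConst p r := by
  have : (2 : ℝ) ^ (p * (1 - r)) < 1 :=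
    Real.rpow_lt_one_of_one_lt_of_neg one_lt_two (mul_neg_of_pos_of_neg (by linarith) (by linarith))
  have : 0 < 1 - (2 : ℝ) ^ (p * (1 - r)) := by linarith
  unfold outerConst
  positivity

theorem tsum_innerWeight_le_ofReal {r t : ℝ} (hp : 1 ≤ p) (hr : r < 2) (ht : 0 < t)
    (hM : weakMoment (r * p) μ x₀ ≠ ∞) :
    ∑' k, innerWeight p (t ^ (1 / p)) k * shellMass μ x₀ k ^ (1 / 2 : ℝ) ≤
      ENNReal.ofReal (√(weakMoment (r * p) μ x₀).toReal * (innerConst p r * t ^ (1 - r / 2))) := by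
  have hp0 : p ≠ 0 := by linarith
  refine (tsum_innerWeight_mul_sqrt_le μ x₀ hp hr (by positivity)).trans (le_of_eq ?_)
  rw [ENNReal.ofReal_mul (Real.sqrt_nonneg (weakMoment (r * p) μ x₀).toReal), Real.sqrt_eq_rpow,
    ← ENNReal.ofReal_rpow_of_nonneg ENNReal.toReal_nonneg (by norm_num), ENNReal.ofReal_toReal hM,
    innerConst, ← Real.rpow_mul ht.le, mul_assoc]
  congr 5
  field_simp

theorem tsum_outerWeight_le_ofReal {r t : ℝ} (hp : 1 ≤ p) (hr : 1 < r) (ht : 0 < t)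
    (hM : weakMoment (r * p) μ x₀ ≠ ∞) :
    ∑' k, outerWeight p (t ^ (1 / p)) k * shellMass μ x₀ k ≤
      ENNReal.ofReal ((weakMoment (r * p) μ x₀).toReal * (outerConst p r * t ^ (1 - r))) := by
  have hp0 : p ≠ 0 := by linarith
  refine (tsum_outerWeight_mul_le μ x₀ hp hr (by positivity)).trans (le_of_eq ?_)
  rw [ENNReal.ofReal_mul (ENNReal.toReal_nonneg (a := weakMoment (r * p) μ x₀)),
    ENNReal.ofReal_toReal hM, outerConst,
    ← Real.rpow_mul ht.le, mul_assoc]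
  congr 5
  field_simp

variable [IsProbabilityMeasure μ]

theorem tsum_shellRadius_mul_ne_top (hp : 1 ≤ p) (hI : tailIntegral p μ x₀ ≠ ∞) :
    ∑' k, (shellRadius k : ℝ≥0∞) ^ p * shellMass μ x₀ k ≠ ∞ := by
  refine ne_top_of_le_ne_top (ENNReal.mul_ne_top ?_ hI)
    (le_trans (ENNReal.tsum_le_tsum fun k => ?_) (tsum_shellRadius_mul_sqrt_le μ x₀ hp))
  · exact ENNReal.rpow_ne_top_of_nonneg (by linarith) (by norm_num)
  · gcongr
    exact le_rpow_half prob_le_one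

theorem strongMoment_ne_top [BorelSpace E] (hp : 1 ≤ p) (hI : tailIntegral p μ x₀ ≠ ∞) :
    strongMoment p μ x₀ ≠ ∞ :=
  ne_top_of_le_ne_top (tsum_shellRadius_mul_ne_top hp hI) (strongMoment_le μ x₀ (by linarith))

/-- A real upper bound for `entropyConst`. -/
noncomputable def entropyBound (p α β : ℝ) : ℝ := (entropyConst p α β).toReal + 1

theorem entropyBound_pos (p α β : ℝ) : 0 < entropyBound p α β :=
  add_pos_of_nonneg_of_pos ENNReal.toReal_nonneg one_pos

theorem entropyConst_le_ofReal (hα : 0 < α) (hαp : α < 2 * p) (hβ : 0 < β) :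
    entropyConst p α β ≤ ENNReal.ofReal (entropyBound p α β) := by
  rw [← ENNReal.ofReal_toReal (entropyConst_ne_top hα hαp hβ)]
  exact ENNReal.ofReal_le_ofReal (by simp [entropyBound])

/-- No truncation: all the weight goes to the Chebyshev piece. -/
theorem measure_wassersteinPow_le_of_tailIntegral [BorelSpace E] (hn : 1 ≤ n)
    (hX : ∀ i, Measurable (X i))
    (hind : iIndepFun X P) (hlaw : ∀ i, P.map (X i) = μ) (hS : ∀ᵐ y ∂μ, y ∈ S) (hp : 1 ≤ p)
    (hα : 0 < α) (hαp : α < 2 * p) (hβ : 0 < β) (h : UniformCovering S x₀ α β)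
    (hI : tailIntegral p μ x₀ ≠ ∞) {x : ℝ} (hx : 0 < x) :
    P.real {ω | ENNReal.ofReal x < wassersteinPow p μ (empiricalMeasure fun i => X i ω)} ≤
      (entropyBound p α β * 4 ^ p * (8 ^ p * 4)) ^ 2 *
        ((tailIntegral p μ x₀).toReal ^ 2 / (x ^ 2 * n)) := by
  have hn0 : (0 : ℝ) < n := by exact_mod_cast hn
  have hK : (0 : ℝ) < 8 ^ p * 4 := by positivity
  set y := x / (8 ^ p * 4)
  have hy : 0 < y := by positivity
  have hxy : x = 8 ^ p * (4 * y) := by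
    simp only [y]
    field_simp
  obtain ⟨L, g, hg, hs, hN, hP⟩ := exists_measure_wassersteinPow_le hp h hn hX hind hlaw hS
    (tsum_shellRadius_mul_ne_top hp hI) hy
  have h1 := hP (fun k => (shellRadius k : ℝ≥0∞) ^ p) (fun _ => 0) fun k => add_zero _
  rw [← hxy] at h1
  refine h1.trans ?_
  have h2 := measure_cellDeviation_ge_le_sq μ L (fun k => (shellRadius k : ℝ≥0∞) ^ p) hn hg hs hN
    (entropyBound_pos p α β).le hy (entropyConst_le_ofReal hα hαp hβ) (by positivity)
    (tsum_shellRadius_mul_sqrt_le_ofReal hp hI)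
  have h3 := measure_cellDeviation_ge_le (s := 0) (y := y) μ L (fun _ => 0) hp hn hg hs le_rfl hy
    (by simp)
  refine (add_le_add h2 h3).trans (le_of_eq ?_)
  simp only [y]
  field_simp
  ring

/-- Truncating where the weight `r_k ^ p` equals `n * x` balances the two pieces: Chebyshev gives `M
* (n x) ^ (2 - r) / (n x ^ 2)` and Markov `M * (n x) ^ (1 - r) / x`, the same order. -/
theorem measure_wassersteinPow_le_of_weakMoment [BorelSpace E] (hn : 1 ≤ n)
    (hX : ∀ i, Measurable (X i))
    (hind : iIndepFun X P) (hlaw : ∀ i, P.map (X i) = μ) (hS : ∀ᵐ y ∂μ, y ∈ S) (hp : 1 ≤ p)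
    (hα : 0 < α) (hαp : α < 2 * p) (hβ : 0 < β) (h : UniformCovering S x₀ α β) {r : ℝ}
    (hr1 : 1 < r) (hr2 : r < 2) (hM : weakMoment (r * p) μ x₀ ≠ ∞) {x : ℝ} (hx : 0 < x) :
    P.real {ω | ENNReal.ofReal x < wassersteinPow p μ (empiricalMeasure fun i => X i ω)} ≤
      ((entropyBound p α β * innerConst p r * (8 ^ p * 4)) ^ 2 +
        4 * outerConst p r * (8 ^ p * 4)) *
        ((weakMoment (r * p) μ x₀).toReal / (x ^ r * (n : ℝ) ^ (r - 1))) := by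
  have hn0 : (0 : ℝ) < n := by exact_mod_cast hn
  have hK : (0 : ℝ) < 8 ^ p * 4 := by positivity
  set M := (weakMoment (r * p) μ x₀).toReal
  have hM0 : 0 ≤ M := ENNReal.toReal_nonneg
  set y := x / (8 ^ p * 4)
  have hy : 0 < y := by positivity
  have hxy : x = 8 ^ p * (4 * y) := by
    simp only [y]
    field_simp
  have ht : 0 < n * x := by positivity
  have hin := tsum_innerWeight_le_ofReal (μ := μ) (x₀ := x₀) hp hr2 ht hM
  have hout := tsum_outerWeight_le_ofReal (μ := μ) (x₀ := x₀) hp hr1 ht hM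
  have hV : ∑' k, (shellRadius k : ℝ≥0∞) ^ p * shellMass μ x₀ k ≠ ∞ := by
    simp_rw [← innerWeight_add_outerWeight p ((n * x) ^ (1 / p)), add_mul]
    rw [ENNReal.tsum_add]
    refine ENNReal.add_ne_top.2 ⟨ne_top_of_le_ne_top ENNReal.ofReal_ne_top
      (le_trans (ENNReal.tsum_le_tsum fun k => ?_) hin),
      ne_top_of_le_ne_top ENNReal.ofReal_ne_top hout⟩
    gcongr
    exact le_rpow_half prob_le_one
  obtain ⟨L, g, hg, hs, hN, hP⟩ := exists_measure_wassersteinPow_le hp h hn hX hind hlaw hS hV hy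
  have h1 := hP _ _ (innerWeight_add_outerWeight p ((n * x) ^ (1 / p)))
  rw [← hxy] at h1
  refine h1.trans ?_
  have hi := innerConst_pos hp hr2
  have ho := outerConst_pos hp hr1
  have h2 := measure_cellDeviation_ge_le_sq μ L _ hn hg hs hN
    (entropyBound_pos p α β).le hy (entropyConst_le_ofReal hα hαp hβ) (by positivity) hin
  have h3 := measure_cellDeviation_ge_le μ L _ hp hn hg hs (by positivity) hy hout
  refine (add_le_add h2 h3).trans (le_of_eq ?_)
  have e1 : ((n * x) ^ (1 - r / 2)) ^ 2 = (n * x) ^ 2 / ((n : ℝ) ^ r * x ^ r) := by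
    rw [← Real.mul_rpow hn0.le hx.le, ← Real.rpow_natCast, ← Real.rpow_mul ht.le,
      ← Real.rpow_natCast, ← Real.rpow_sub ht]
    congr 1
    push_cast
    ring
  have e2 : (n * x) ^ (1 - r) = (n * x) / ((n : ℝ) ^ r * x ^ r) := by
    rw [← Real.mul_rpow hn0.le hx.le, Real.rpow_sub ht, Real.rpow_one]
  have e3 : (n : ℝ) ^ (r - 1) = (n : ℝ) ^ r / n := by
    rw [Real.rpow_sub hn0, Real.rpow_one]
  have hnr : (0 : ℝ) < (n : ℝ) ^ r := by positivity
  have hxr : (0 : ℝ) < x ^ r := by positivity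
  rw [mul_pow, mul_pow, mul_pow, Real.sq_sqrt hM0, e1, e2, e3]
  simp only [y, M]
  field_simp

/-- The constant of the polynomial term of the Fuk-Nagaev inequality. -/
noncomputable def fukNagaevConst (p q : ℝ) : ℝ :=
  Real.exp (3 * q / 2) * ((48 * q) ^ (q / 2) * (4 ^ p * (8 ^ p * 4)) ^ q)

/-- The constant of the weak moment term of the Fuk-Nagaev inequality. -/
noncomputable def fukNagaevTailConst (p q r : ℝ) : ℝ :=
  4 * outerConst p r * (3 * q) ^ (r - 1) * (8 ^ p * 4) ^ r

/-- The constant of the subgaussian term. -/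
noncomputable def subgaussianConst (p α β : ℝ) : ℝ :=
  2 / (entropyBound p α β * 4 ^ p * (8 ^ p * 4)) ^ 2

/-- Either alternative of `hmean` makes the mean of the inner deviation at most `y`, the first
through the strong moment and the second through the rate `I / √n`. The rest is Fuk-Nagaev inside
and Markov outside. -/
theorem measure_wassersteinPow_le_of_weakMoment_of_mean [BorelSpace E] (hn : 1 ≤ n)
    (hX : ∀ i, Measurable (X i)) (hind : iIndepFun X P) (hlaw : ∀ i, P.map (X i) = μ)
    (hS : ∀ᵐ y ∂μ, y ∈ S) (hp : 1 ≤ p) (hα : 0 < α) (hαp : α < 2 * p) (hβ : 0 < β)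
    (h : UniformCovering S x₀ α β) {r q : ℝ}
    (hr : 2 < r) (hqr : r < q) (hM : weakMoment (r * p) μ x₀ ≠ ∞)
    (hI : tailIntegral p μ x₀ ≠ ∞) (hI0 : 0 < (tailIntegral p μ x₀).toReal) {x : ℝ} (hx : 0 < x)
    (hmean : 16 * 16 ^ p * (strongMoment p μ x₀).toReal < x ∨
      2 < n * subgaussianConst p α β * (x / (tailIntegral p μ x₀).toReal) ^ 2) :
    P.real {ω | ENNReal.ofReal x < wassersteinPow p μ (empiricalMeasure fun i => X i ω)} ≤
      fukNagaevConst p q *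
        ((tailIntegral p μ x₀).toReal ^ q / (x ^ q * (n : ℝ) ^ (q / 2))) +
      fukNagaevTailConst p q r *
        ((weakMoment (r * p) μ x₀).toReal / (x ^ r * (n : ℝ) ^ (r - 1))) := by
  have hn0 : (0 : ℝ) < n := by exact_mod_cast hn
  have hq : 0 < q := by linarith
  have hp0 : 0 < p := by linarith
  have hK : (0 : ℝ) < 8 ^ p * 4 := by positivity
  set M := (weakMoment (r * p) μ x₀).toReal
  set I := (tailIntegral p μ x₀).toReal
  have hM0 : 0 ≤ M := ENNReal.toReal_nonneg
  set y := x / (8 ^ p * 4)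
  have hy : 0 < y := by positivity
  have hxy : x = 8 ^ p * (4 * y) := by
    simp only [y]
    field_simp
  obtain ⟨L, g, hg, hs, hN, hP⟩ := exists_measure_wassersteinPow_le hp h hn hX hind hlaw hS
    (tsum_shellRadius_mul_ne_top hp hI) hy
  -- The cutoff on weights is the largest one that `measure_cellDeviation_ge_le_rpow` allows.
  set t := n * y / (3 * q)
  have ht : 0 < t := by positivity
  set T := t ^ (1 / p)
  have hTp : T ^ p = t := by
    simp only [T]
    rw [← Real.rpow_mul ht.le, one_div_mul_cancel hp0.ne', Real.rpow_one]
  have hout := tsum_outerWeight_le_ofReal (μ := μ) (x₀ := x₀) hp (by linarith) ht hM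
  have h1 := hP _ _ (innerWeight_add_outerWeight p T)
  rw [← hxy] at h1
  refine h1.trans ?_
  have ho := outerConst_pos hp (r := r) (by linarith)
  have hsE := tsum_shellRadius_mul_sqrt_le_ofReal (μ := μ) (x₀ := x₀) hp hI
  have hm : ∫⁻ z, deviation (cellWeight p L (innerWeight p T)) (cell g L) μ z
      ∂(Measure.pi fun _ : Fin n => μ) ≤ ENNReal.ofReal y := by
    rcases hmean with hmean | hmean
    -- The mean is at most `4 * 2 ^ p` times the strong moment; against `y = x / (8 ^ p * 4)` this
    -- is the threshold `16 * 16 ^ p`.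
    · have hsm := strongMoment_ne_top (μ := μ) (x₀ := x₀) hp hI
      refine (lintegral_cellDeviation_le μ L (innerWeight p T) hp hn hg hs
        (s := 2 ^ p * (strongMoment p μ x₀).toReal) ?_).trans (ENNReal.ofReal_le_ofReal ?_)
      · calc _ ≤ ∑' k, (shellRadius k : ℝ≥0∞) ^ p * shellMass μ x₀ k :=
              ENNReal.tsum_le_tsum fun k => mul_le_mul' (innerWeight_le p T k) le_rfl
          _ ≤ _ := tsum_shellRadius_mul_le_strongMoment μ x₀ hp0.le
          _ = _ := by
              rw [ENNReal.ofReal_mul (by positivity), ENNReal.ofReal_toReal hsm,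
                ← ENNReal.ofReal_rpow_of_pos two_pos, ENNReal.ofReal_ofNat]
      · simp only [y]
        rw [le_div_iff₀ hK]
        refine le_trans (le_of_eq ?_) hmean.le
        rw [show (16 : ℝ) ^ p = 2 ^ p * 8 ^ p by
          rw [← Real.mul_rpow (by norm_num) (by norm_num)]
          norm_num]
        ring
    · refine (lintegral_cellDeviation_le_mul μ L (innerWeight p T) hn hg hs hN
        (entropyBound_pos p α β).le (entropyConst_le_ofReal hα hαp hβ)
        (le_trans (ENNReal.tsum_le_tsum fun k => mul_le_mul' (innerWeight_le p T k) le_rfl)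
          hsE)).trans (ENNReal.ofReal_le_ofReal ?_)
      have hE := entropyBound_pos p α β
      have hsn : 0 < √(n : ℝ) := Real.sqrt_pos.2 hn0
      rw [div_le_iff₀ hsn]
      simp only [y]
      rw [div_mul_eq_mul_div, le_div_iff₀ hK]
      refine le_of_sq_le_sq ?_ (by positivity)
      -- The 2 in `subgaussianConst` cancels the threshold 2 in `hmean`, leaving exactly the squared
      -- inequality needed.
      rw [mul_pow x, Real.sq_sqrt hn0.le]
      simp only [subgaussianConst] at hmean
      rw [div_pow, mul_div_assoc', lt_div_iff₀ (by positivity), mul_div_assoc',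
        div_mul_eq_mul_div, lt_div_iff₀ (by positivity)] at hmean
      nlinarith
  have h2 := measure_cellDeviation_ge_le_rpow μ L (innerWeight p T) hp hn hg hs
    (s := 4 ^ p * I) (by positivity) hy hq
    (innerWeight_le p T) (fun k => by
      have := innerWeight_le_ofReal (T := T) hp0.le (by positivity) k
      rwa [hTp] at this) hsE hm
  have h3 := measure_cellDeviation_ge_le μ L _ hp hn hg hs (by positivity) hy hout
  refine (add_le_add h2 h3).trans (le_of_eq ?_)
  congr 1
  · have e : 12 * q * (4 * (4 ^ p * I) ^ 2 / n) / y ^ 2 =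
        48 * q * (4 ^ p * (8 ^ p * 4) * I / x) ^ 2 / n := by
      simp only [y]
      field_simp
      ring
    have e4 : ((4 ^ p * (8 ^ p * 4) * I / x) ^ 2) ^ (q / 2) =
        (4 ^ p * (8 ^ p * 4)) ^ q * I ^ q / x ^ q := by
      rw [← Real.rpow_natCast, ← Real.rpow_mul (by positivity), Real.div_rpow (by positivity) hx.le,
        Real.mul_rpow (by positivity) hI0.le]
      push_cast
      rw [mul_div_cancel₀ q two_ne_zero]
    rw [e, Real.div_rpow (by positivity) hn0.le, Real.mul_rpow (by positivity) (by positivity), e4,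
      fukNagaevConst]
    have : 0 < x ^ q := by positivity
    have : 0 < (n : ℝ) ^ (q / 2) := by positivity
    field_simp
  · have e2 : t ^ (1 - r) = n * y * (3 * q) ^ (r - 1) / ((n : ℝ) ^ r * y ^ r) := by
      simp only [t]
      rw [Real.div_rpow (by positivity) (by positivity), ← Real.mul_rpow hn0.le hy.le,
        Real.rpow_sub (by positivity), Real.rpow_one, ← neg_sub r 1,
        Real.rpow_neg (by positivity)]
      field_simp
    have e3 : (n : ℝ) ^ (r - 1) = (n : ℝ) ^ r / n := by
      rw [Real.rpow_sub hn0, Real.rpow_one]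
    have e4 : y ^ r = x ^ r / (8 ^ p * 4) ^ r := Real.div_rpow hx.le hK.le r
    have hnr : (0 : ℝ) < (n : ℝ) ^ r := by positivity
    have hxr : (0 : ℝ) < x ^ r := by positivity
    have hyr : (0 : ℝ) < y ^ r := by positivity
    rw [e2, e3, fukNagaevTailConst]
    have e5 : x ^ r = y ^ r * (8 ^ p * 4) ^ r := by
      rw [e4, div_mul_cancel₀ _ (by positivity)]
    rw [e5]
    simp only [M]
    field_simp

end Regimes

end EmpiricalWasserstein

/-! ### Assembly of the theorem. -/

theorem mainTheorem2 :
    -- the constants: each depends only on the parameters among `p, α, β, q, r` that it takes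
    ∃ (A : ℝ → ℝ)  -- `C_p` in the indicator
      (B : ℝ → ℝ → ℝ → ℝ)  -- `C_{p,α,β}` in the exponential
      (D : ℝ → ℝ → ℝ → ℝ)  -- `C_{p,q,r}`
      (F : ℝ → ℝ → ℝ → ℝ)  -- `C_{p,α,β}` in the second regime
      (G : ℝ → ℝ → ℝ → ℝ → ℝ),  -- `C_{p,α,β,r}` in the third regime
      (∀ p, 0 < A p) ∧ (∀ p α β, 0 < B p α β) ∧ (∀ p q r, 0 < D p q r) ∧
      (∀ p α β, 0 < F p α β) ∧ (∀ p α β r, 0 < G p α β r) ∧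
      ∀ (E : Type*) [MetricSpace E] [CompleteSpace E] [SecondCountableTopology E]
        [MeasurableSpace E] [BorelSpace E]
        (Ω : Type*) [MeasurableSpace Ω] (P : Measure Ω) [IsProbabilityMeasure P]
        (μ : Measure E) [IsProbabilityMeasure μ] (x₀ : E) (S : Set E)
        (n : ℕ) (X : Fin n → Ω → E) (p α β : ℝ),
        1 ≤ n →
        (∀ i, Measurable (X i)) → iIndepFun X P → (∀ i, P.map (X i) = μ) →
        (∀ᵐ y ∂μ, y ∈ S) →
        1 ≤ p → 0 < α → α < 2 * p → 0 < β →
        EmpiricalWasserstein.UniformCovering S x₀ α β →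
        -- first regime: weak moment of order `rp` with `r > 2`
        (∀ r : ℝ, 2 < r → EmpiricalWasserstein.weakMoment (r * p) μ x₀ ≠ ∞ →
          EmpiricalWasserstein.tailIntegral p μ x₀ ≠ ∞ ∧
          EmpiricalWasserstein.strongMoment p μ x₀ ≠ ∞ ∧
          ∀ q x : ℝ, r < q → 0 < x →
            P.real {ω | ENNReal.ofReal x < EmpiricalWasserstein.wassersteinPow p μ
                (EmpiricalWasserstein.empiricalMeasure fun i => X i ω)} ≤
              (if x ≤ A p * (EmpiricalWasserstein.strongMoment p μ x₀).toReal then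
                Real.exp 2 * Real.exp (-(n * B p α β *
                  (x / (EmpiricalWasserstein.tailIntegral p μ x₀).toReal) ^ 2))
              else 0) +
              D p q r *
                ((EmpiricalWasserstein.tailIntegral p μ x₀).toReal ^ q /
                    (x ^ q * (n : ℝ) ^ (q / 2)) +
                  (EmpiricalWasserstein.weakMoment (r * p) μ x₀).toReal /
                    (x ^ r * (n : ℝ) ^ (r - 1)))) ∧
        -- second regime: `I_{2p,p} < ∞`
        (EmpiricalWasserstein.tailIntegral p μ x₀ ≠ ∞ →
          ∀ x : ℝ, 0 < x →
            P.real {ω | ENNReal.ofReal x < EmpiricalWasserstein.wassersteinPow p μ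
                (EmpiricalWasserstein.empiricalMeasure fun i => X i ω)} ≤
              F p α β * ((EmpiricalWasserstein.tailIntegral p μ x₀).toReal ^ 2 /
                (x ^ 2 * n))) ∧
        -- third regime: weak moment of order `rp` with `1 < r < 2`
        (∀ r : ℝ, 1 < r → r < 2 → EmpiricalWasserstein.weakMoment (r * p) μ x₀ ≠ ∞ →
          ∀ x : ℝ, 0 < x →
            P.real {ω | ENNReal.ofReal x < EmpiricalWasserstein.wassersteinPow p μ
                (EmpiricalWasserstein.empiricalMeasure fun i => X i ω)} ≤
              G p α β r * ((EmpiricalWasserstein.weakMoment (r * p) μ x₀).toReal /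
                (x ^ r * (n : ℝ) ^ (r - 1)))) := by
  refine ⟨fun p => 16 * 16 ^ p, EmpiricalWasserstein.subgaussianConst,
    -- Absolute values and `+ 1` give positivity for all real parameters, also where the formulas
    -- have no meaning.
    fun p q r => |EmpiricalWasserstein.fukNagaevConst p q| +
      |EmpiricalWasserstein.fukNagaevTailConst p q r| + 1,
    fun p α β => (EmpiricalWasserstein.entropyBound p α β * 4 ^ p * (8 ^ p * 4)) ^ 2,
    fun p α β r =>
      (EmpiricalWasserstein.entropyBound p α β * EmpiricalWasserstein.innerConst p r *
        (8 ^ p * 4)) ^ 2 + |4 * EmpiricalWasserstein.outerConst p r * (8 ^ p * 4)| + 1,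
    fun p => by positivity, fun p α β => ?_, fun p q r => by positivity, fun p α β => ?_,
    fun p α β r => by positivity, ?_⟩
  · have := EmpiricalWasserstein.entropyBound_pos p α β
    unfold EmpiricalWasserstein.subgaussianConst
    positivity
  · have := EmpiricalWasserstein.entropyBound_pos p α β
    positivity
  intro E _ _ _ _ _ Ω _ P _ μ _ x₀ S n X p α β hn hX hind hlaw hS hp hα hαp hβ hcov
  refine ⟨fun r hr hM => ?_, fun hI x hx => ?_, fun r hr1 hr2 hM x hx => ?_⟩
  · have hI := EmpiricalWasserstein.tailIntegral_ne_top μ x₀ hp hr hM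
    refine ⟨hI, EmpiricalWasserstein.strongMoment_ne_top hp hI, fun q x hqr hx => ?_⟩
    set I := (EmpiricalWasserstein.tailIntegral p μ x₀).toReal
    have hI0 : 0 ≤ I := ENNReal.toReal_nonneg
    set M := (EmpiricalWasserstein.weakMoment (r * p) μ x₀).toReal
    have hM0 : 0 ≤ M := ENNReal.toReal_nonneg
    have hif0 : ∀ (c : Prop) [Decidable c] (a : ℝ), 0 ≤ a → 0 ≤ if c then a else 0 := by
      intro c _ a ha
      split_ifs
      · exact ha
      · exact le_rfl
    have hD : 0 ≤ (|EmpiricalWasserstein.fukNagaevConst p q| +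
        |EmpiricalWasserstein.fukNagaevTailConst p q r| + 1) *
        (I ^ q / (x ^ q * (n : ℝ) ^ (q / 2)) + M / (x ^ r * (n : ℝ) ^ (r - 1))) := by positivity
    -- In this case the exponential term is at least `exp (2 - 2) = 1`, so the bound is trivial;
    -- otherwise that term is dropped.
    by_cases htriv : x ≤ 16 * 16 ^ p * (EmpiricalWasserstein.strongMoment p μ x₀).toReal ∧
        n * EmpiricalWasserstein.subgaussianConst p α β * (x / I) ^ 2 ≤ 2
    · rw [if_pos htriv.1]
      refine measureReal_le_one.trans ?_
      have h1 : 1 ≤ Real.exp 2 * Real.exp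
          (-(n * EmpiricalWasserstein.subgaussianConst p α β * (x / I) ^ 2)) := by
        rw [← Real.exp_add]
        exact Real.one_le_exp (by linarith [htriv.2])
      linarith
    · refine le_trans ?_ (le_add_of_nonneg_left (hif0 _ _ (by positivity)))
      -- If `I = 0` the second regime already shows that the probability vanishes.
      rcases hI0.eq_or_lt with h0 | hIpos
      · have h2 := EmpiricalWasserstein.measure_wassersteinPow_le_of_tailIntegral hn hX hind hlaw
          hS hp hα hαp hβ hcov hI hx
        have h3 : (EmpiricalWasserstein.tailIntegral p μ x₀).toReal = 0 := h0.symm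
        rw [h3] at h2
        refine h2.trans (le_trans (le_of_eq ?_) hD)
        simp
      · have hor : 16 * 16 ^ p * (EmpiricalWasserstein.strongMoment p μ x₀).toReal < x ∨
            2 < n * EmpiricalWasserstein.subgaussianConst p α β * (x / I) ^ 2 := by
          by_contra hcon
          rw [not_or, not_lt, not_lt] at hcon
          exact htriv hcon
        refine (EmpiricalWasserstein.measure_wassersteinPow_le_of_weakMoment_of_mean hn hX hind
          hlaw hS hp hα hαp hβ hcov hr hqr hM hI hIpos hx hor).trans ?_
        rw [mul_add]
        have a1 := le_abs_self (EmpiricalWasserstein.fukNagaevConst p q)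
        have a2 := le_abs_self (EmpiricalWasserstein.fukNagaevTailConst p q r)
        have a3 := abs_nonneg (EmpiricalWasserstein.fukNagaevConst p q)
        have a4 := abs_nonneg (EmpiricalWasserstein.fukNagaevTailConst p q r)
        exact add_le_add (mul_le_mul_of_nonneg_right (by linarith) (by positivity))
          (mul_le_mul_of_nonneg_right (by linarith) (by positivity))
  · exact EmpiricalWasserstein.measure_wassersteinPow_le_of_tailIntegral hn hX hind hlaw
      hS hp hα hαp hβ hcov hI hx
  · refine (EmpiricalWasserstein.measure_wassersteinPow_le_of_weakMoment hn hX hind hlaw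
      hS hp hα hαp hβ hcov hr1 hr2 hM hx).trans ?_
    refine mul_le_mul_of_nonneg_right ?_ (by positivity)
    have := le_abs_self (4 * EmpiricalWasserstein.outerConst p r * (8 ^ p * 4))
    linarith
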